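/- Let $p\ge 2$ be an integer and let $\mu_p=E|Z|^p$ with $Z\sim N(0,1)$. Let $M=(M_t)_{t\ge0}$ be a real-valued martingale on a filtered probability space $(\Omega,\mathcal F,\mathbb F=(\mathcal F_t)_{t\ge0},P)$ with $M_0=0$ and $E|M_t|^p<\infty$ for every $t\ge0$. For $\delta>0$ and $t\ge0$ put $$V_{p,\delta}(t)=\delta^{1-\frac p2}\sum_{1\le k\le\lfloor t/\delta\rfloor}|M_{k\delta}-M_{(k-1)\delta}|^p .$$ **(I)** Suppose that the compensator $A=\langle M\rangle$ of $M$ is of the form $A_t=\int_0^t a_s\,ds$ for a non-negative, continuous, adapted process $a$, and that $M=B\circ A$ almost surely, that is $M_t=B_{A_t}$ for all $t\ge0$, for some Brownian motion $B$ such that the processes $A$ and $B$ are independent. Put $$U_{p,\delta}(t)=\delta^{1-\frac p2}\sum_{1\le k\le\lfloor t/\delta\rfloor}(A_{k\delta}-A_{(k-1)\delta})^{\frac p2},\qquad \mathcal U_p(t)=\int_0^t a_s^{\frac p2}\,ds .$$ 1. For $0\le s\le t<\infty$ the variables $|M_t-M_s|^p$ and $(A_t-A_s)^{p/2}$ are integrable,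 and almost surely $$E\big(|M_t-M_s|^p\,\big|\,\mathcal G_s\big)=\mu_p\,E\big((A_t-A_s)^{\frac p2}\,\big|\,\mathcal G_s\big)$$ for $\mathcal G_s=\sigma(M_u,A_u:u\le s)$. The same identity holds with $\mathcal G_s=\mathcal F_s$ whenever $\mathbb F$ is compatible with the representation $M=B\circ A$, in the sense that for every $s\ge0$ the process $(B_{A_s+u}-B_{A_s})_{u\ge0}$ is independent of $\mathcal F_s\vee\sigma(A_u:u\ge0)$. 2. Almost surely, $U_{p,\delta}\to\mathcal U_p$ as $\delta\downarrow0$, uniformly on every compact interval $[0,T]$. 3. If in addition $E|M_t|^{2p}<\infty$ for every $t\ge0$, then $V_{p,\delta}\to\mathcal V_p:=\mu_p\,\mathcal U_p$ in probability, uniformly on compact time sets: for all $T\ge0$ and $\varepsilon>0$, $P\big(\sup_{0\le t\le T}|V_{p,\delta}(t)-\mathcal V_p(t)|\ge\varepsilon\big)\to0$ as $\delta\downarrow0$. **(II)** In particular, if $E|M_t|^{2p}<\infty$ for every $t\ge 0$ and $M_t=\int_0^t\sigma_s\,dW_s$ (Itô integral) for some Brownian motion $W$ and some continuous non-negative process $\sigma$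 independent of $W$, then $V_{p,\delta}$ converges in probability, uniformly on compact time sets, to $\mathcal V_p(t)=\mu_p\int_0^t\sigma_s^p\,ds$ as $\delta\downarrow0$. -/

import Mathlib

open MeasureTheory ProbabilityTheory Filter Topology
open scoped NNReal ENNReal

noncomputable section

namespace PVariation

/-- The absolute moment `E |Z| ^ p` of a standard normal variable `Z`. -/
def absMoment (p : ℕ) : ℝ := ∫ x : ℝ, |x| ^ p ∂(gaussianReal 0 1)

/-- The integrated process `t ↦ ∫_0^t a_u du`. -/
def integrated {Ω : Type*} (a : ℝ≥0 → Ω → ℝ) (t : ℝ≥0) (ω : Ω) : ℝ :=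
  ∫ u in (0 : ℝ)..(t : ℝ), a u.toNNReal ω

/-- `A` is the (predictable) compensator of the square integrable martingale `M`: it is predictable,
null at `0`, has nondecreasing right continuous paths, and `M ^ 2 - A` is a martingale. -/
structure IsCompensator {Ω : Type*} {mΩ : MeasurableSpace Ω} (A M : ℝ≥0 → Ω → ℝ)
    (𝓕 : Filtration ℝ≥0 mΩ) (P : Measure Ω) : Prop where
  predictable : IsStronglyPredictable 𝓕 A
  null_at_zero : ∀ᵐ ω ∂P, A 0 ω = 0
  mono : ∀ᵐ ω ∂P, Monotone (fun t => A t ω)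
  right_cont : ∀ᵐ ω ∂P, ∀ t, ContinuousWithinAt (fun u => A u ω) (Set.Ici t) t
  martingale : Martingale (fun t ω => M t ω ^ 2 - A t ω) 𝓕 P

/-- The normalized `p`-variation
`V_{p,δ}(t) = δ^{1-p/2} ∑_{1 ≤ k ≤ ⌊t/δ⌋} |X(kδ) - X((k-1)δ)|^p`;
the index `k` of the sum is shifted by one below. -/
def normVariation {Ω : Type*} (p : ℕ) (X : ℝ≥0 → Ω → ℝ) (δ t : ℝ≥0) (ω : Ω) : ℝ :=
  (δ : ℝ) ^ (1 - (p : ℝ) / 2) *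
    ∑ k ∈ Finset.range ⌊t / δ⌋₊, |X ((k + 1 : ℕ) * δ) ω - X ((k : ℕ) * δ) ω| ^ p

/-- The sum
`U_{p,δ}(t) = δ^{1-p/2} ∑_{1 ≤ k ≤ ⌊t/δ⌋} (A(kδ) - A((k-1)δ))^{p/2}`. -/
def normPowerSum {Ω : Type*} (p : ℕ) (A : ℝ≥0 → Ω → ℝ) (δ t : ℝ≥0) (ω : Ω) : ℝ :=
  (δ : ℝ) ^ (1 - (p : ℝ) / 2) *
    ∑ k ∈ Finset.range ⌊t / δ⌋₊, (A ((k + 1 : ℕ) * δ) ω - A ((k : ℕ) * δ) ω) ^ ((p : ℝ) / 2)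

/-- Convergence in probability, uniformly on compact time sets, as `δ ↓ 0`:
`P (sup_{t ≤ T} |X_δ(t) - Y(t)| ≥ ε) → 0` for all `T` and all `ε > 0`. -/
def TendstoUCP {Ω : Type*} {mΩ : MeasurableSpace Ω} (X : ℝ≥0 → ℝ≥0 → Ω → ℝ)
    (Y : ℝ≥0 → Ω → ℝ) (P : Measure Ω) : Prop :=
  ∀ T : ℝ≥0, ∀ ε : ℝ, 0 < ε →
    Tendsto (fun δ => P {ω | ∃ t ≤ T, ε ≤ |X δ t ω - Y t ω|}) (𝓝[>] 0) (𝓝 0)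

/-- The σ-algebra generated by `X_u` and `Y_u`, `u ≤ s`. -/
abbrev past {Ω : Type*} (X Y : ℝ≥0 → Ω → ℝ) (s : ℝ≥0) : MeasurableSpace Ω :=
  ⨆ u : Set.Iic s, (MeasurableSpace.comap (X u) inferInstance ⊔
    MeasurableSpace.comap (Y u) inferInstance)

/-- The Brownian motion `B`, restarted at the random time `A_s`, is independent of
`σ(A) ∨ 𝓕_s`, for every `s`. -/
def IsFreshAfter {Ω : Type*} {mΩ : MeasurableSpace Ω} (B A : ℝ≥0 → Ω → ℝ)
    (𝓕 : Filtration ℝ≥0 mΩ) (P : Measure Ω) : Prop :=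
  ∀ s : ℝ≥0, Indep
    ((⨆ u : ℝ≥0, MeasurableSpace.comap (A u) inferInstance) ⊔ 𝓕 s)
    (MeasurableSpace.comap
      (fun ω (u : ℝ≥0) => B ((A s ω).toNNReal + u) ω - B (A s ω).toNNReal ω) inferInstance)
    P

/-- `E(|M_t - M_s|^p | 𝓖) = μ_p E((A_t - A_s)^{p/2} | 𝓖)` almost surely, all variables involved
being integrable. -/
def CondMomentIdentity {Ω : Type*} {mΩ : MeasurableSpace Ω} (P : Measure Ω) (p : ℕ)
    (M A : ℝ≥0 → Ω → ℝ) (s t : ℝ≥0) (𝓖 : MeasurableSpace Ω) : Prop :=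
  Integrable (fun ω => |M t ω - M s ω| ^ p) P ∧
  Integrable (fun ω => (A t ω - A s ω) ^ ((p : ℝ) / 2)) P ∧
  P[fun ω => |M t ω - M s ω| ^ p | 𝓖] =ᵐ[P]
    fun ω => absMoment p * (P[fun ω' => (A t ω' - A s ω') ^ ((p : ℝ) / 2) | 𝓖]) ω

/-- The left-point Riemann sum of mesh `δ`,
`∑_k σ(kδ) (W((k+1)δ ∧ t) - W(kδ ∧ t))`; terms with `kδ > t` vanish. -/
def itoSum {Ω : Type*} (σ W : ℝ≥0 → Ω → ℝ) (δ t : ℝ≥0) (ω : Ω) : ℝ :=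
  ∑ k ∈ Finset.range (⌊t / δ⌋₊ + 1),
    σ ((k : ℕ) * δ) ω * (W (min ((k + 1 : ℕ) * δ) t) ω - W (min ((k : ℕ) * δ) t) ω)

/-- `M_t = ∫_0^t σ_s dW_s` for a Brownian motion `W` and a process `σ` with continuous paths:
`M` has continuous paths and the left-point Riemann sums converge to `M` in probability, uniformly
on compact time sets. -/
structure IsItoIntegral {Ω : Type*} {mΩ : MeasurableSpace Ω} (M σ W : ℝ≥0 → Ω → ℝ)
    (P : Measure Ω) : Prop where
  cont : ∀ᵐ ω ∂P, Continuous (fun t => M t ω)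
  tendsto : TendstoUCP (itoSum σ W) M P

end PVariation

end

/-! Given the path of `A`, the increments of `M = B ∘ A` over the blocks of length δ are independent
centred normal variables whose variances are the increments of `A`. So the conditional p-th moment
of an increment is μ_p (ΔA)^{p/2}, which yields the moment identity, and the conditional second
moment of the centred sum ∑ (|ΔM|^p - μ_p (ΔA)^{p/2}) is at most μ_{2p} ∑ (ΔA)^p.

For the convergence, localize to the event where a ≤ N on [0, T], whose complement has small
probability. There the bound is μ_{2p} n (Nδ)^p, and the squared normalization δ^{2-p} turns it into
O(δ). By Chebyshev, V - μ_p U tends to 0 in probability at each fixed time. The convergence of U is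
pathwise: by the mean value theorem U is a Riemann sum of a^{p/2}. Uniformity in time is a Pólya
type argument: V is nondecreasing, and the limit is nondecreasing and Lipschitz on the event, so
finitely many times suffice.

For an Itô integral no time change is built. With σ frozen, the approximating Riemann sums are
finite Wiener sums, hence Gaussian, and obey the same second moment bound; Fatou's lemma along an
almost surely convergent subsequence of meshes carries it to `M`.

Conditioning on a path is done by `lintegral_freeze`, the second moment bound is
`lintegral_sq_sum_abs_pow_sub_le`, and both convergence statements come from
`tendstoUCP_normVariation`. -/

noncomputable section

namespace PVariation

/-! ### Fubini for functionals of a process and an independent random element. -/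

section Freezing

variable {Ω : Type*} {mΩ : MeasurableSpace Ω} {P : Measure Ω}

/-- The value at `x` of a right-continuous path, computed from its values at the points
`k / (n + 1)`. -/
@[irreducible] def evalGrid (x : ℝ≥0) (b : ℕ × ℕ → ℝ) : ℝ :=
  limsup (fun n : ℕ => b (n, ⌈(n + 1 : ℝ≥0) * x⌉₊)) atTop

/-- Evaluation (x, f) ↦ f x is not jointly measurable on the full product path space. A limsup of
countably many coordinates is, and it agrees with evaluation on continuous paths. -/
theorem measurable_evalGrid : Measurable (fun z : ℝ≥0 × (ℕ × ℕ → ℝ) => evalGrid z.1 z.2) := by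
  unfold evalGrid
  refine Measurable.limsup fun n => ?_
  have h : Measurable (fun y : (ℕ × ℕ → ℝ) × ℕ => y.1 (n, y.2)) :=
    measurable_from_prod_countable_left fun k => measurable_pi_apply (n, k)
  have hc : Measurable fun z : ℝ≥0 × (ℕ × ℕ → ℝ) => ⌈(n + 1 : ℝ≥0) * z.1⌉₊ :=
    Nat.measurable_ceil.comp (measurable_fst.const_mul _)
  exact h.comp (measurable_snd.prodMk hc)

theorem tendsto_ceil_mul_div (x : ℝ≥0) :
    Tendsto (fun n : ℕ => (⌈(n + 1 : ℝ≥0) * x⌉₊ : ℝ≥0) / (n + 1)) atTop (𝓝 x) := by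
  have h := (tendsto_nat_ceil_mul_div_atTop (R := ℝ) (a := (x : ℝ)) x.2).comp
    (tendsto_natCast_atTop_atTop.comp (tendsto_add_atTop_nat 1))
  rw [← NNReal.tendsto_coe]
  refine h.congr fun n => ?_
  have hc : ⌈(n + 1 : ℝ≥0) * x⌉₊ = ⌈(x : ℝ) * ((n + 1 : ℕ) : ℝ)⌉₊ := by
    refine eq_of_forall_ge_iff fun k => ?_
    rw [Nat.ceil_le, Nat.ceil_le, ← NNReal.coe_le_coe]
    push_cast
    rw [mul_comm]
  simp [Function.comp, hc]

/-- The values of a process at the points `k / (n + 1)`. -/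
def gridValues (B : ℝ≥0 → Ω → ℝ) (ω : Ω) (i : ℕ × ℕ) : ℝ := B ((i.2 : ℝ≥0) / (i.1 + 1)) ω

theorem evalGrid_gridValues {B : ℝ≥0 → Ω → ℝ} {ω : Ω} (h : Continuous (B · ω)) (x : ℝ≥0) :
    evalGrid x (gridValues B ω) = B x ω := by
  unfold evalGrid
  exact ((h.tendsto x).comp (tendsto_ceil_mul_div x)).limsup_eq

theorem aemeasurable_gridValues {B : ℝ≥0 → Ω → ℝ} (hB : ∀ u, AEMeasurable (B u) P) :
    AEMeasurable (gridValues B) P :=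
  aemeasurable_pi_lambda _ fun _ => hB _

theorem aemeasurable_comp_time {B : ℝ≥0 → Ω → ℝ} (hB : ∀ u, AEMeasurable (B u) P)
    (hc : ∀ᵐ ω ∂P, Continuous (B · ω)) {τ : Ω → ℝ≥0} (hτ : AEMeasurable τ P) :
    AEMeasurable (fun ω => B (τ ω) ω) P := by
  refine (measurable_evalGrid.comp_aemeasurable
    (hτ.prodMk (aemeasurable_gridValues hB))).congr ?_
  filter_upwards [hc] with ω h using evalGrid_gridValues h _

/-- Independent freezing: if `X` is independent of the process `B` with continuous paths, then
functionals of `X` and of `B` at times depending on `X` are integrated by freezing `X` first. -/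
theorem lintegral_freeze {E ι : Type*} [MeasurableSpace E] [Countable ι] [IsProbabilityMeasure P]
    {X : Ω → E} (hX : AEMeasurable X P) {B : ℝ≥0 → Ω → ℝ} (hB : ∀ u, AEMeasurable (B u) P)
    (hc : ∀ᵐ ω ∂P, Continuous (B · ω)) (hXB : IndepFun X (fun ω u => B u ω) P)
    {τ : ι → E → ℝ≥0} (hτ : ∀ i, Measurable (τ i)) {Φ : E × (ι → ℝ) → ℝ≥0∞} (hΦ : Measurable Φ) :
    ∫⁻ ω, Φ (X ω, fun i => B (τ i (X ω)) ω) ∂P =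
      ∫⁻ ω, ∫⁻ ω', Φ (X ω, fun i => B (τ i (X ω)) ω') ∂P ∂P := by
  have hb := aemeasurable_gridValues hB
  have hres : Measurable fun (f : ℝ≥0 → ℝ) (i : ℕ × ℕ) => f ((i.2 : ℝ≥0) / (i.1 + 1)) :=
    measurable_pi_lambda _ fun i => measurable_pi_apply ((i.2 : ℝ≥0) / (i.1 + 1))
  -- Only countably many coordinates of `B` are kept: the joint law with `X` is then a product
  -- measure on which `g` is measurable, and Tonelli applies.
  have hind : IndepFun X (gridValues B) P := hXB.comp measurable_id hres
  have hmap := (indepFun_iff_map_prod_eq_prod_map_map hX hb).1 hind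
  have hψ : Measurable fun z : E × (ℕ × ℕ → ℝ) => Φ (z.1, fun i => evalGrid (τ i z.1) z.2) :=
by
    have h1 : ∀ i, Measurable fun z : E × (ℕ × ℕ → ℝ) => evalGrid (τ i z.1) z.2 := fun i =>
      measurable_evalGrid.comp (((hτ i).comp measurable_fst).prodMk measurable_snd)
    exact hΦ.comp (measurable_fst.prodMk (measurable_pi_lambda _ h1))
  set g : E × (ℕ × ℕ → ℝ) → ℝ≥0∞ := fun z => Φ (z.1, fun i => evalGrid (τ i z.1) z.2) with hg
  have hgB : ∀ e ω, Continuous (B · ω) →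
      g (e, gridValues B ω) = Φ (e, fun i => B (τ i e) ω) := fun e ω h => by
    simp only [hg, evalGrid_gridValues h]
  have := Measure.isProbabilityMeasure_map hX
  have := Measure.isProbabilityMeasure_map hb
  calc ∫⁻ ω, Φ (X ω, fun i => B (τ i (X ω)) ω) ∂P
      = ∫⁻ ω, g (X ω, gridValues B ω) ∂P := by
        refine lintegral_congr_ae ?_
        filter_upwards [hc] with ω h using (hgB _ _ h).symm
    _ = ∫⁻ z, g z ∂(P.map fun ω => (X ω, gridValues B ω)) :=
        (lintegral_map' hψ.aemeasurable (hX.prodMk hb)).symm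
    _ = ∫⁻ x, ∫⁻ b, g (x, b) ∂(P.map (gridValues B)) ∂(P.map X) := by
        rw [hmap, lintegral_prod _ hψ.aemeasurable]
    _ = ∫⁻ ω, ∫⁻ b, g (X ω, b) ∂(P.map (gridValues B)) ∂P :=
        lintegral_map' hψ.lintegral_prod_right'.aemeasurable hX
    _ = ∫⁻ ω, ∫⁻ ω', Φ (X ω, fun i => B (τ i (X ω)) ω') ∂P ∂P := by
        refine lintegral_congr fun ω => ?_
        have hψω : Measurable fun b => g (X ω, b) := hψ.comp measurable_prodMk_left
        rw [lintegral_map' hψω.aemeasurable hb]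
        refine lintegral_congr_ae ?_
        filter_upwards [hc] with ω' h using hgB _ _ h

end Freezing

/-! ### Absolute moments of normal variables. -/

section Gaussian

variable {Ω : Type*} {mΩ : MeasurableSpace Ω} {P : Measure Ω}

theorem integrable_abs_pow_gaussianReal (p : ℕ) (v : ℝ≥0) :
    Integrable (fun x : ℝ => |x| ^ p) (gaussianReal 0 v) :=
  (memLp_id_gaussianReal (p : ℝ≥0)).integrable_norm_pow'

theorem absMoment_nonneg (p : ℕ) : 0 ≤ absMoment p := integral_nonneg fun _ => by positivity

/-- Strict positivity permits division by μ_p, both for the integrability of (A_t - A_s)^{p/2} and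
for the choice of a deviation threshold. -/
theorem absMoment_pos (p : ℕ) : 0 < absMoment p := by
  rw [absMoment, integral_pos_iff_support_of_nonneg (fun _ => by positivity)
    (integrable_abs_pow_gaussianReal p 1)]
  have h : (Function.support fun x : ℝ => |x| ^ p)ᶜ ⊆ {0} := fun x hx => by
    simp only [Set.mem_compl_iff, Function.mem_support, not_not] at hx
    simpa using eq_zero_of_pow_eq_zero hx
  have : NullSingletonClass (gaussianReal 0 1) := nullSingletonClass_gaussianReal one_ne_zero
  have h0 : gaussianReal 0 1 (Function.support fun x : ℝ => |x| ^ p)ᶜ = 0 :=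
    measure_mono_null h (measure_singleton _)
  rw [pos_iff_ne_zero]
  intro h1
  have := measure_union_le (μ := gaussianReal 0 1) (Function.support fun x : ℝ => |x| ^ p)
    (Function.support fun x : ℝ => |x| ^ p)ᶜ
  simp [h0, h1] at this

/-- Scaling: N(0, v) is the law of √v Z. -/
theorem integral_abs_pow_gaussianReal (p : ℕ) (v : ℝ≥0) :
    ∫ x, |x| ^ p ∂(gaussianReal 0 v) = absMoment p * (v : ℝ) ^ ((p : ℝ) / 2) := by
  have h := gaussianReal_map_const_mul (μ := 0) (v := 1) (√(v : ℝ))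
  have hv : NNReal.mk (√(v : ℝ) ^ 2) (sq_nonneg _) * 1 = v := by
    ext; simp
  rw [mul_zero, hv] at h
  rw [← h, integral_map (by fun_prop) (by fun_prop), absMoment]
  simp_rw [abs_mul, mul_pow, integral_const_mul]
  rw [mul_comm, abs_of_nonneg (Real.sqrt_nonneg _), Real.sqrt_eq_rpow, ← Real.rpow_natCast,
    ← Real.rpow_mul v.coe_nonneg]
  congr 2; ring

theorem lintegral_abs_pow_of_hasLaw {Y : Ω → ℝ} {v : ℝ≥0} (h : HasLaw Y (gaussianReal 0 v) P)
    (p : ℕ) : ∫⁻ ω, ENNReal.ofReal (|Y ω| ^ p) ∂P =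
      ENNReal.ofReal (absMoment p * (v : ℝ) ^ ((p : ℝ) / 2)) := by
  rw [← integral_abs_pow_gaussianReal, ofReal_integral_eq_lintegral_ofReal
    (integrable_abs_pow_gaussianReal p v) (ae_of_all _ fun _ => by positivity), ← h.map_eq,
    lintegral_map' (by fun_prop) h.aemeasurable]

/-- Second moment bound for the centred sum of `p`-th powers of independent centred normal
variables. -/
theorem lintegral_sq_sum_abs_pow_sub_le [IsProbabilityMeasure P] (p : ℕ) {ι : Type*} (s : Finset ι)
    (Y : ι → Ω → ℝ) (v : ι → ℝ≥0) (hY : ∀ k ∈ s, HasLaw (Y k) (gaussianReal 0 (v k)) P)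
    (hind : Set.Pairwise (s : Set ι) fun j k => IndepFun (Y j) (Y k) P) :
    ∫⁻ ω, ENNReal.ofReal ((∑ k ∈ s, (|Y k ω| ^ p - absMoment p * (v k : ℝ) ^ ((p : ℝ) / 2))) ^ 2) ∂P
      ≤ ENNReal.ofReal (absMoment (2 * p) * ∑ k ∈ s, (v k : ℝ) ^ p) := by
  have hmem : ∀ k ∈ s, MemLp (fun ω => |Y k ω| ^ p) 2 P := fun k hk => by
    refine (memLp_two_iff_integrable_sq
      ((hY k hk).aemeasurable.abs.pow_const p).aestronglyMeasurable).2 ?_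
    have := integrable_abs_pow_gaussianReal (2 * p) (v k)
    rw [← (hY k hk).map_eq] at this
    have h2 := this.comp_aemeasurable (hY k hk).aemeasurable
    refine h2.congr (ae_of_all _ fun ω => ?_)
    simp only [Function.comp]; ring
  have hmean : ∀ k ∈ s, ∫ ω, |Y k ω| ^ p ∂P = absMoment p * (v k : ℝ) ^ ((p : ℝ) / 2) :=
    fun k hk => by
      rw [← integral_abs_pow_gaussianReal, ← (hY k hk).map_eq,
        integral_map (hY k hk).aemeasurable (by fun_prop)]
  have hvar : ∀ k ∈ s, Var[fun ω => |Y k ω| ^ p; P] ≤ absMoment (2 * p) * (v k : ℝ) ^ p :=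
    fun k hk => by
      refine (variance_le_expectation_sq (hmem k hk).aestronglyMeasurable).trans (le_of_eq ?_)
      have : ∫ x, |x| ^ (2 * p) ∂(gaussianReal 0 (v k)) = absMoment (2 * p) * (v k : ℝ) ^ p := by
        rw [integral_abs_pow_gaussianReal, ← Real.rpow_natCast _ p]
        congr 2; push_cast; ring
      rw [← this, ← (hY k hk).map_eq, integral_map (hY k hk).aemeasurable (by fun_prop)]
      refine integral_congr_ae (ae_of_all _ fun ω => ?_)
      simp only [Pi.pow_apply]; ring
  have hS : MemLp (∑ k ∈ s, fun ω => |Y k ω| ^ p) 2 P := memLp_finsetSum' s hmem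
  have hE : ∫ ω, (∑ k ∈ s, fun ω => |Y k ω| ^ p) ω ∂P =
      ∑ k ∈ s, absMoment p * (v k : ℝ) ^ ((p : ℝ) / 2) := by
    simp_rw [Finset.sum_apply]
    rw [integral_finsetSum _ fun k hk => (hmem k hk).integrable one_le_two]
    exact Finset.sum_congr rfl hmean
  -- The sum is centred at its mean, so its second moment is a variance. Pairwise independence makes
  -- the variance additive, and each term is at most E|Y_k|^{2p} = μ_{2p} v_k^p.
  calc _ = evariance (∑ k ∈ s, fun ω => |Y k ω| ^ p) P := by
        rw [evariance_eq_lintegral_ofReal, hE]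
        simp_rw [Finset.sum_apply, Finset.sum_sub_distrib]
    _ = ENNReal.ofReal (Var[∑ k ∈ s, fun ω => |Y k ω| ^ p; P]) := hS.ofReal_variance_eq.symm
    _ ≤ _ := by
        refine ENNReal.ofReal_le_ofReal ?_
        rw [IndepFun.variance_sum hmem fun j hj k hk hjk =>
          (hind hj hk hjk).comp (φ := fun x : ℝ => |x| ^ p) (ψ := fun x : ℝ => |x| ^ p)
            (by fun_prop) (by fun_prop), Finset.mul_sum]
        exact Finset.sum_le_sum hvar

end Gaussian

/-! ### Pathwise convergence of Riemann sums and of the normalized power sums. -/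

section Paths

variable {Ω : Type*} {a : ℝ≥0 → Ω → ℝ} {ω : Ω}

theorem continuous_toNNReal_comp (hc : Continuous (a · ω)) :
    Continuous fun u : ℝ => a u.toNNReal ω :=
  hc.comp continuous_real_toNNReal

theorem integrated_sub (hc : Continuous (a · ω)) (s t : ℝ≥0) :
    integrated a t ω - integrated a s ω = ∫ u in (s : ℝ)..t, a u.toNNReal ω :=
  intervalIntegral.integral_interval_sub_left
    ((continuous_toNNReal_comp hc).intervalIntegrable _ _)
    ((continuous_toNNReal_comp hc).intervalIntegrable _ _)

theorem integrated_mono (hc : Continuous (a · ω)) (h0 : ∀ t, 0 ≤ a t ω) :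
    Monotone (integrated a · ω) := fun s t hst => by
  rw [← sub_nonneg, integrated_sub hc]
  exact intervalIntegral.integral_nonneg hst fun u _ => h0 _

theorem integrated_nonneg (h0 : ∀ t, 0 ≤ a t ω) (t : ℝ≥0) : 0 ≤ integrated a t ω :=
  intervalIntegral.integral_nonneg t.2 fun _ _ => h0 _

theorem integrated_sub_le (hc : Continuous (a · ω)) {N : ℝ} {s t : ℝ≥0} (hst : s ≤ t)
    (hN : ∀ u ≤ t, a u ω ≤ N) : integrated a t ω - integrated a s ω ≤ N * (t - s) := by
  rw [integrated_sub hc]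
  refine (intervalIntegral.integral_mono_on (NNReal.coe_le_coe.2 hst)
    ((continuous_toNNReal_comp hc).intervalIntegrable _ _) intervalIntegrable_const
    fun u hu => hN _ (Real.toNNReal_le_iff_le_coe.2 hu.2)).trans (le_of_eq ?_)
  simp [mul_comm]

/-- The mean value theorem for integrals, which makes `normPowerSum` an exact tagged Riemann sum. -/
theorem exists_integrated_sub_eq (hc : Continuous (a · ω)) {s t : ℝ≥0} (hst : s < t) :
    ∃ ξ, s ≤ ξ ∧ ξ ≤ t ∧ integrated a t ω - integrated a s ω = a ξ ω * (t - s) := by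
  have hst' : (s : ℝ) < t := NNReal.coe_lt_coe.2 hst
  obtain ⟨c, hc1, hc2⟩ := exists_eq_interval_average hst'.ne
    (continuous_toNNReal_comp hc).continuousOn
  rw [Set.uIoo_of_lt hst'] at hc1
  refine ⟨c.toNNReal, NNReal.le_toNNReal_of_coe_le hc1.1.le,
    Real.toNNReal_le_iff_le_coe.2 hc1.2.le, ?_⟩
  rw [integrated_sub hc, hc2, interval_average_eq_div, div_mul_cancel₀ _ (sub_pos.2 hst').ne']

theorem floor_div_mul_le (t δ : ℝ≥0) : (⌊t / δ⌋₊ : ℝ≥0) * δ ≤ t := by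
  rcases eq_or_ne δ 0 with rfl | h
  · simp
  · calc (⌊t / δ⌋₊ : ℝ≥0) * δ ≤ t / δ * δ := by gcongr; exact Nat.floor_le zero_le
      _ = t := div_mul_cancel₀ _ h

/-- Riemann sums of a continuous path converge uniformly on compact time sets. -/
theorem riemann_sum_close (hc : Continuous (a · ω)) (T : ℝ≥0) {η : ℝ} (hη : 0 < η) :
    ∃ δ₀ : ℝ≥0, 0 < δ₀ ∧ ∀ δ : ℝ≥0, 0 < δ → δ < δ₀ → ∀ ξ : ℕ → ℝ≥0,
      (∀ k : ℕ, (k : ℕ) * δ ≤ ξ k ∧ ξ k ≤ (k + 1 : ℕ) * δ) → ∀ t ≤ T,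
      |∑ k ∈ Finset.range ⌊t / δ⌋₊, (δ : ℝ) * a (ξ k) ω - integrated a t ω| ≤ η := by
  have hK : IsCompact (Set.Icc 0 T) := isCompact_Icc
  obtain ⟨K, hK1⟩ := hK.exists_bound_of_continuousOn hc.continuousOn
  have hK0 : 0 ≤ K := (norm_nonneg _).trans (hK1 0 ⟨le_rfl, zero_le⟩)
  -- The error has two halves. Oscillation of the path at most η/(2(T+1)) per unit length costs η/2
  -- over the full blocks; the incomplete last block costs Kδ ≤ η/2. Writing T + 1 and K + 1 avoids
  -- division by zero.
  have hη1 : 0 < η / (2 * ((T : ℝ) + 1)) := by positivity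
  obtain ⟨δ₁, hδ₁, huc⟩ := Metric.uniformContinuousOn_iff.1
    (hK.uniformContinuousOn_of_continuous hc.continuousOn) _ hη1
  refine ⟨min ⟨δ₁, hδ₁.le⟩ ⟨η / (2 * (K + 1)), by positivity⟩,
    lt_min hδ₁ (show (0 : ℝ) < η / (2 * (K + 1)) by positivity), fun δ hδ hδ0 ξ hξ t ht => ?_⟩
  have hδ1 : (δ : ℝ) < δ₁ := NNReal.coe_lt_coe.2 (hδ0.trans_le (min_le_left _ _))
  have hδ2 : (δ : ℝ) < η / (2 * (K + 1)) := NNReal.coe_lt_coe.2 (hδ0.trans_le (min_le_right _ _))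
  have hδ' : (0 : ℝ) < δ := hδ
  set n := ⌊t / δ⌋₊ with hn
  have hnt : (n : ℝ≥0) * δ ≤ t := floor_div_mul_le t δ
  have hnt' : (n : ℝ) * δ ≤ t := by exact_mod_cast hnt
  have hnt2 : (t : ℝ) - n * δ ≤ δ := by
    have : t / δ ≤ n + 1 := (Nat.lt_floor_add_one _).le
    have h2 : t ≤ (n + 1) * δ := (div_le_iff₀ hδ).1 this
    have h3 : (t : ℝ) ≤ (n + 1) * δ := by exact_mod_cast h2
    linarith
  have htel : integrated a (n * δ) ω = ∑ k ∈ Finset.range n,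
      (integrated a ((k + 1 : ℕ) * δ) ω - integrated a ((k : ℕ) * δ) ω) := by
    rw [Finset.sum_range_sub (fun k : ℕ => integrated a (k * δ) ω)]
    simp [integrated]
  have hblock : ∀ k ∈ Finset.range n, |(δ : ℝ) * a (ξ k) ω -
      (integrated a ((k + 1 : ℕ) * δ) ω - integrated a ((k : ℕ) * δ) ω)| ≤
      η / (2 * ((T : ℝ) + 1)) * δ := fun k hk => by
    have hkn : ((k + 1 : ℕ) : ℝ≥0) * δ ≤ T :=
      le_trans (by gcongr; exact Finset.mem_range.1 hk) (hnt.trans ht)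
    have hlt : (k : ℝ≥0) * δ < (k + 1 : ℕ) * δ := by
      gcongr; exact Nat.lt_succ_self k
    obtain ⟨c, hc1, hc2, hc3⟩ := exists_integrated_sub_eq hc hlt
    have hd : (((k + 1 : ℕ) * δ : ℝ≥0) : ℝ) - ((k * δ : ℝ≥0) : ℝ) = δ := by push_cast; ring
    rw [hc3, hd, mul_comm, ← sub_mul, abs_mul, abs_of_pos hδ']
    gcongr
    have hdist : dist (ξ k) c < δ₁ := by
      refine lt_of_le_of_lt ?_ hδ1
      rw [NNReal.dist_eq, abs_le]
      have e1 : ((k * δ : ℝ≥0) : ℝ) ≤ ξ k := (hξ k).1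
      have e2 : (ξ k : ℝ) ≤ (((k + 1 : ℕ) * δ : ℝ≥0) : ℝ) := (hξ k).2
      have e3 : ((k * δ : ℝ≥0) : ℝ) ≤ c := hc1
      have e4 : (c : ℝ) ≤ (((k + 1 : ℕ) * δ : ℝ≥0) : ℝ) := hc2
      constructor <;> linarith
    exact (huc _ ⟨zero_le, (hξ k).2.trans hkn⟩ _ ⟨zero_le, hc2.trans hkn⟩ hdist).le
  have hrem : |integrated a t ω - integrated a (n * δ) ω| ≤ K * δ := by
    rw [integrated_sub hc]
    refine (intervalIntegral.norm_integral_le_of_norm_le_const (C := K)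
      (f := fun u : ℝ => a u.toNNReal ω) fun u hu => ?_).trans ?_
    · have hle : ((n * δ : ℝ≥0) : ℝ) ≤ t := hnt
      rw [Set.uIoc_of_le hle] at hu
      exact hK1 _ ⟨zero_le, (Real.toNNReal_le_iff_le_coe.2 hu.2).trans ht⟩
    · gcongr
      push_cast
      rw [abs_of_nonneg (sub_nonneg.2 hnt')]
      exact hnt2
  have hsum : |∑ k ∈ Finset.range n, (δ : ℝ) * a (ξ k) ω - integrated a (n * δ) ω| ≤ η / 2 := by
    rw [htel, ← Finset.sum_sub_distrib]
    refine (Finset.abs_sum_le_sum_abs _ _).trans ((Finset.sum_le_sum hblock).trans ?_)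
    have hT : (n : ℝ) * δ ≤ T + 1 := hnt'.trans ((NNReal.coe_le_coe.2 ht).trans (by linarith))
    rw [Finset.sum_const, Finset.card_range, nsmul_eq_mul]
    calc (n : ℝ) * (η / (2 * ((T : ℝ) + 1)) * δ) = η / (2 * ((T : ℝ) + 1)) * (n * δ) := by ring
      _ ≤ η / (2 * ((T : ℝ) + 1)) * (T + 1) := by gcongr
      _ = η / 2 := by field_simp
  have hK2 : K * δ ≤ η / 2 := by
    rw [lt_div_iff₀ (by positivity)] at hδ2
    nlinarith
  calc _ = |(∑ k ∈ Finset.range n, (δ : ℝ) * a (ξ k) ω - integrated a (n * δ) ω) -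
        (integrated a t ω - integrated a (n * δ) ω)| := by congr 1; ring
    _ ≤ _ := (abs_sub _ _).trans (by linarith)

/-- With q = p/2 this explains the normalization δ^{1-p/2}: it leaves exactly one factor δ, the mesh
of a Riemann sum. -/
theorem rpow_mul_rpow_mul {δ x q : ℝ} (hδ : 0 < δ) (hx : 0 ≤ x) :
    δ ^ (1 - q) * (x * δ) ^ q = δ * x ^ q := by
  rw [Real.mul_rpow hx hδ.le, mul_left_comm, ← Real.rpow_add hδ]
  simp [mul_comm]

/-- The normalized power sums of an integrated process converge, uniformly on compact sets. -/
theorem tendstoUniformlyOn_normPowerSum (p : ℕ) (hc : Continuous (a · ω))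
    (h0 : ∀ t, 0 ≤ a t ω) (T : ℝ≥0) :
    TendstoUniformlyOn (fun δ t => normPowerSum p (integrated a) δ t ω)
      (fun t => integrated (fun u ω' => a u ω' ^ ((p : ℝ) / 2)) t ω) (𝓝[>] 0) (Set.Iic T) := by
  have hg : Continuous (fun t => a t ω ^ ((p : ℝ) / 2)) :=
    hc.rpow_const fun t => Or.inr (by positivity)
  rw [Metric.tendstoUniformlyOn_iff]
  intro ε hε
  obtain ⟨δ₀, hδ₀, H⟩ := riemann_sum_close (a := fun u ω' => a u ω' ^ ((p : ℝ) / 2)) (ω := ω) hg T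
    (half_pos hε)
  filter_upwards [Ioo_mem_nhdsGT hδ₀] with δ hδ t ht
  have hlt : ∀ k : ℕ, (k : ℝ≥0) * δ < (k + 1 : ℕ) * δ := fun k => by
    have := hδ.1
    gcongr; exact Nat.lt_succ_self k
  choose ξ h1 h2 h3 using fun k : ℕ => exists_integrated_sub_eq hc (hlt k)
  have hd : ∀ k : ℕ, (((k + 1 : ℕ) * δ : ℝ≥0) : ℝ) - ((k * δ : ℝ≥0) : ℝ) = δ := fun k => by
    push_cast; ring
  have hsum : normPowerSum p (integrated a) δ t ω =
      ∑ k ∈ Finset.range ⌊t / δ⌋₊, (δ : ℝ) * a (ξ k) ω ^ ((p : ℝ) / 2) := by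
    rw [normPowerSum, Finset.mul_sum]
    refine Finset.sum_congr rfl fun k _ => ?_
    rw [h3 k, hd]
    exact rpow_mul_rpow_mul (NNReal.coe_pos.2 hδ.1) (h0 _)
  rw [dist_comm, Real.dist_eq, hsum]
  exact (H δ hδ.1 hδ.2 ξ (fun k => ⟨h1 k, h2 k⟩) t ht).trans_lt (half_lt_self hε)

end Paths

/-! ### Measurability of the integrated process and of the localizing events. -/

section Measurability

variable {Ω : Type*} {mΩ : MeasurableSpace Ω} {a : ℝ≥0 → Ω → ℝ}

theorem measurable_integrated (ha : ∀ t, Measurable (a t)) (hc : ∀ ω, Continuous (a · ω))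
    (t : ℝ≥0) : Measurable (integrated a t) := by
  have h1 : Measurable (Function.uncurry a) :=
    measurable_uncurry_of_continuous_of_measurable hc ha
  have h2 : Measurable fun z : Ω × ℝ => a z.2.toNNReal z.1 :=
    h1.comp ((measurable_real_toNNReal.comp measurable_snd).prodMk measurable_fst)
  have h3 := (h2.stronglyMeasurable.integral_prod_right'
    (ν := volume.restrict (Set.Ioc (0 : ℝ) t))).measurable
  have h4 : integrated a t = fun ω => ∫ u in Set.Ioc (0 : ℝ) t, a u.toNNReal ω := by
    ext ω
    exact intervalIntegral.integral_of_le t.2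
  rw [h4]
  exact h3

theorem measurableSet_forall_le (ha : ∀ t, Measurable (a t)) (hc : ∀ ω, Continuous (a · ω))
    (T : ℝ≥0) (N : ℝ) : MeasurableSet {ω | ∀ u ≤ T, a u ω ≤ N} := by
  -- Continuity of the path reduces the condition to a dense sequence; capping its points at `T`
  -- keeps them in the interval.
  have : {ω | ∀ u ≤ T, a u ω ≤ N} =
      ⋂ n : ℕ, {ω | a (min (TopologicalSpace.denseSeq ℝ≥0 n) T) ω ≤ N} := by
    ext ω
    simp only [Set.mem_ofPred_eq, Set.mem_iInter]
    refine ⟨fun h n => h _ (min_le_right _ _), fun h u hu => ?_⟩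
    have hcl : IsClosed {q : ℝ≥0 | a (min q T) ω ≤ N} :=
      isClosed_le ((hc ω).comp (continuous_id.min continuous_const)) continuous_const
    have := (TopologicalSpace.denseRange_denseSeq ℝ≥0).induction_on
      (p := fun q => a (min q T) ω ≤ N) u hcl h
    simpa [min_eq_left hu] using this
  rw [this]
  exact MeasurableSet.iInter fun n => measurableSet_le (ha _) measurable_const

theorem tendsto_measure_forall_le_compl {P : Measure Ω} [IsFiniteMeasure P]
    (ha : ∀ t, Measurable (a t)) (hc : ∀ ω, Continuous (a · ω)) (T : ℝ≥0) :
    Tendsto (fun N : ℕ => P {ω | ∀ u ≤ T, a u ω ≤ N}ᶜ) atTop (𝓝 0) := by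
  have h := tendsto_measure_iInter_atTop (μ := P)
    (s := fun N : ℕ => {ω | ∀ u ≤ T, a u ω ≤ N}ᶜ)
    (fun N => (measurableSet_forall_le ha hc T N).compl.nullMeasurableSet)
    (fun m n hmn => Set.compl_subset_compl.2 fun ω h u hu =>
      (h u hu).trans (Nat.cast_le.2 hmn)) ⟨0, measure_ne_top _ _⟩
  -- Each continuous path is bounded on the compact interval, so it leaves these events once N is
  -- large.
  have hempty : ⋂ N : ℕ, {ω | ∀ u ≤ T, a u ω ≤ N}ᶜ = ∅ := by
    rw [← Set.compl_iUnion, Set.compl_empty_iff, Set.eq_univ_iff_forall]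
    intro ω
    obtain ⟨K, hK⟩ := (isCompact_Icc (a := 0) (b := T)).exists_bound_of_continuousOn
      (hc ω).continuousOn
    obtain ⟨N, hN⟩ := exists_nat_ge K
    exact Set.mem_iUnion.2 ⟨N, fun u hu =>
      (le_abs_self _).trans ((hK u ⟨zero_le, hu⟩).trans hN)⟩
  rw [hempty, measure_empty] at h
  exact h

end Measurability

/-! ### From a second moment bound to uniform convergence in probability. -/

section UCP

variable {Ω : Type*} {mΩ : MeasurableSpace Ω} {P : Measure Ω}

theorem normVariation_mono (p : ℕ) (X : ℝ≥0 → Ω → ℝ) (δ : ℝ≥0) (ω : Ω) :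
    Monotone fun t => normVariation p X δ t ω := fun s t hst => by
  refine mul_le_mul_of_nonneg_left ?_ (Real.rpow_nonneg δ.2 _)
  refine Finset.sum_le_sum_of_subset_of_nonneg ?_ fun _ _ _ => by positivity
  exact Finset.range_mono (Nat.floor_mono (by gcongr))

/-- The centred sum of the `p`-th powers of the increments over the first `n` blocks. -/
def centredSum (p : ℕ) (M A : ℝ≥0 → Ω → ℝ) (δ : ℝ≥0) (n : ℕ) (ω : Ω) : ℝ :=
  ∑ k ∈ Finset.range n, (|M ((k + 1 : ℕ) * δ) ω - M ((k : ℕ) * δ) ω| ^ p -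
    absMoment p * (A ((k + 1 : ℕ) * δ) ω - A ((k : ℕ) * δ) ω) ^ ((p : ℝ) / 2))

theorem normVariation_sub_normPowerSum (p : ℕ) (M A : ℝ≥0 → Ω → ℝ) (δ t : ℝ≥0) (ω : Ω) :
    normVariation p M δ t ω - absMoment p * normPowerSum p A δ t ω =
      (δ : ℝ) ^ (1 - (p : ℝ) / 2) * centredSum p M A δ ⌊t / δ⌋₊ ω := by
  rw [normVariation, normPowerSum, centredSum, Finset.sum_sub_distrib, ← Finset.mul_sum]
  ring

theorem aemeasurable_centredSum {p : ℕ} {M A : ℝ≥0 → Ω → ℝ} (hM : ∀ t, AEMeasurable (M t) P)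
    (hA : ∀ t, AEMeasurable (A t) P) (δ : ℝ≥0) (n : ℕ) :
    AEMeasurable (centredSum p M A δ n) P := by
  refine Finset.aemeasurable_fun_sum _ fun k _ => ?_
  exact (((hM _).sub (hM _)).abs.pow_const _).sub
    ((((hA _).sub (hA _)).pow_const _).const_mul _)

/-- Markov's inequality for the deviation of the normalized variation, on an event `S` where the
second moment of the centred sum is controlled. -/
theorem measure_deviation_le {p : ℕ} {M A : ℝ≥0 → Ω → ℝ} (hM : ∀ t, AEMeasurable (M t) P)
    (hA : ∀ t, AEMeasurable (A t) P) {S : Set Ω} (hS : MeasurableSet S) {C N : ℝ} (hC : 0 ≤ C)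
    (hN : 0 ≤ N) {δ t : ℝ≥0} (hδ : 0 < δ)
    (h : ∫⁻ ω in S, ENNReal.ofReal (centredSum p M A δ ⌊t / δ⌋₊ ω ^ 2) ∂P ≤
      ENNReal.ofReal (C * (⌊t / δ⌋₊ * (N * δ) ^ p))) {ε : ℝ} (hε : 0 < ε) :
    P (S ∩ {ω | ε ≤ |normVariation p M δ t ω - absMoment p * normPowerSum p A δ t ω|}) ≤
      ENNReal.ofReal (C * N ^ p * t / ε ^ 2 * δ) := by
  set c : ℝ := (δ : ℝ) ^ (1 - (p : ℝ) / 2) with hc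
  have hδ' : (0 : ℝ) < δ := hδ
  have hcpos : 0 < c := Real.rpow_pos_of_pos hδ' _
  -- The exponents add to (2 - p) + p = 2, so the n blocks contribute n δ² ≤ t δ.
  have hc2 : c ^ 2 * (δ : ℝ) ^ p = δ ^ 2 := by
    rw [hc, ← Real.rpow_natCast, ← Real.rpow_natCast, ← Real.rpow_natCast, ← Real.rpow_mul hδ'.le,
      ← Real.rpow_add hδ']
    congr 1; push_cast; ring
  have hnt : (⌊t / δ⌋₊ : ℝ) * δ ≤ t := by exact_mod_cast floor_div_mul_le t δ
  have hε2 : 0 < ENNReal.ofReal ((ε / c) ^ 2) := ENNReal.ofReal_pos.2 (by positivity)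
  calc P (S ∩ {ω | ε ≤ |normVariation p M δ t ω - absMoment p * normPowerSum p A δ t ω|})
      ≤ (P.restrict S) {ω | ENNReal.ofReal ((ε / c) ^ 2) ≤
          ENNReal.ofReal (centredSum p M A δ ⌊t / δ⌋₊ ω ^ 2)} := by
        rw [Measure.restrict_apply' hS, Set.inter_comm]
        refine measure_mono (Set.inter_subset_inter_left _ fun ω hω => ?_)
        refine ENNReal.ofReal_le_ofReal ?_
        simp only [Set.mem_ofPred_eq, normVariation_sub_normPowerSum, ← hc, abs_mul,
          abs_of_pos hcpos] at hω
        rw [← sq_abs (centredSum p M A δ ⌊t / δ⌋₊ ω)]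
        have : ε / c ≤ |centredSum p M A δ ⌊t / δ⌋₊ ω| := by
          rw [div_le_iff₀ hcpos, mul_comm]; exact hω
        gcongr
    _ ≤ (∫⁻ ω in S, ENNReal.ofReal (centredSum p M A δ ⌊t / δ⌋₊ ω ^ 2) ∂P) /
          ENNReal.ofReal ((ε / c) ^ 2) :=
        meas_ge_le_lintegral_div
          ((aemeasurable_centredSum hM hA δ _).pow_const 2).ennreal_ofReal.restrict hε2.ne'
          ENNReal.ofReal_ne_top
    _ ≤ ENNReal.ofReal (C * (⌊t / δ⌋₊ * (N * δ) ^ p)) / ENNReal.ofReal ((ε / c) ^ 2) := by gcongr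
    _ = ENNReal.ofReal (C * (⌊t / δ⌋₊ * (N * δ) ^ p) / (ε / c) ^ 2) :=
        (ENNReal.ofReal_div_of_pos (by positivity)).symm
    _ ≤ _ := by
        refine ENNReal.ofReal_le_ofReal ?_
        have : C * (⌊t / δ⌋₊ * (N * δ) ^ p) / (ε / c) ^ 2 =
            C * N ^ p / ε ^ 2 * (⌊t / δ⌋₊ * (c ^ 2 * δ ^ p)) := by
          rw [mul_pow, div_pow]; field_simp
        rw [this, hc2]
        calc C * N ^ p / ε ^ 2 * (⌊t / δ⌋₊ * (δ : ℝ) ^ 2)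
            = C * N ^ p / ε ^ 2 * (⌊t / δ⌋₊ * δ) * δ := by ring
          _ ≤ C * N ^ p / ε ^ 2 * t * δ := by gcongr
          _ = _ := by ring

/-- A monotone function close on a grid to a Lipschitz monotone function is uniformly close. -/
theorem abs_sub_lt_of_grid {f g : ℝ≥0 → ℝ} (hf : Monotone f) (hg : Monotone g) {T : ℝ≥0} {L ε : ℝ}
    (hL : ∀ s t, s ≤ t → t ≤ T → g t - g s ≤ L * (t - s)) {m : ℕ} (hm : 0 < m)
    (hLm : L * (T / m) ≤ ε / 2)
    (hfg : ∀ i ≤ m, |f (i * (T / m)) - g (i * (T / m))| < ε / 2) {t : ℝ≥0}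
    (ht : t ≤ T) : |f t - g t| < ε := by
  have hm' : (m : ℝ≥0) ≠ 0 := by positivity
  -- A grid block containing `t`. If there were none, induction would push every grid point below
  -- `t`, and finally T < t.
  obtain ⟨i, hi, h1, h2⟩ : ∃ i : ℕ, i < m ∧ (i : ℝ≥0) * (T / m) ≤ t ∧
      t ≤ ((i + 1 : ℕ) : ℝ≥0) * (T / m) := by
    by_contra! hcon
    have hall : ∀ i : ℕ, i ≤ m → (i : ℝ≥0) * (T / m) ≤ t := fun i => by
      induction i with
      | zero => intro _; simp
      | succ i ih => exact fun hi => (hcon i hi (ih (by omega))).le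
    have h3 := hcon (m - 1) (by omega) (hall _ (by omega))
    rw [Nat.sub_add_cancel hm, mul_div_cancel₀ _ hm'] at h3
    exact absurd ht (not_le.2 h3)
  have hiT : ((i + 1 : ℕ) : ℝ≥0) * (T / m) ≤ T := by
    calc ((i + 1 : ℕ) : ℝ≥0) * (T / m) ≤ m * (T / m) := by gcongr; exact hi
      _ = T := mul_div_cancel₀ _ hm'
  have ha := abs_lt.1 (hfg i hi.le)
  have hb := abs_lt.1 (hfg (i + 1) hi)
  have hd : L * ((((i + 1 : ℕ) : ℝ≥0) * (T / m) : ℝ≥0) - ((i : ℝ≥0) * (T / m) : ℝ≥0)) ≤ ε / 2 := by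
    push_cast
    convert hLm using 2; ring
  -- On this block f t ≤ f(right end) < g(right end) + ε/2 ≤ g(left end) + ε ≤ g t + ε, and
  -- symmetrically from below.
  have e1 := hL _ _ (h1.trans h2) hiT
  have e2 := hf h1
  have e3 := hf h2
  have e4 := hg h1
  have e5 := hg h2
  have e6 := hg (h1.trans h2)
  rw [abs_lt]
  constructor <;> linarith

/-- Pathwise convergence implies convergence in measure along sequences, and sequences suffice
because the filter `𝓝[>] 0` is countably generated. -/
theorem tendsto_measure_normPowerSum_deviation [IsProbabilityMeasure P] (p : ℕ)
    {a : ℝ≥0 → Ω → ℝ} (ha : ∀ t, Measurable (a t)) (hc : ∀ ω, Continuous (a · ω))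
    (h0 : ∀ t ω, 0 ≤ a t ω) (t : ℝ≥0) {ε : ℝ} (hε : 0 < ε) :
    Tendsto (fun δ => P {ω | ε ≤ |normPowerSum p (integrated a) δ t ω -
      integrated (fun u ω' => a u ω' ^ ((p : ℝ) / 2)) t ω|}) (𝓝[>] 0) (𝓝 0) := by
  refine tendsto_of_seq_tendsto fun δ hδ => ?_
  have hA := measurable_integrated ha hc
  have hmeas : ∀ d, Measurable (normPowerSum p (integrated a) d t) := fun d =>
    (Finset.measurable_fun_sum _ fun k _ => ((hA _).sub (hA _)).pow_const _).const_mul _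
  have h := tendstoInMeasure_of_tendsto_ae (μ := P)
    (f := fun n => normPowerSum p (integrated a) (δ n) t)
    (g := integrated (fun u ω' => a u ω' ^ ((p : ℝ) / 2)) t)
    (fun n => (hmeas _).aestronglyMeasurable) (ae_of_all _ fun ω =>
      ((tendstoUniformlyOn_normPowerSum p (hc ω) (h0 · ω) t).tendsto_at Set.self_mem_Iic).comp hδ)
  rw [tendstoInMeasure_iff_norm] at h
  exact h ε hε

/-- Convergence of the normalized `p`-variation from a bound for the second moment of the centred
sum on the events where `a` is bounded. -/
theorem tendstoUCP_normVariation [IsProbabilityMeasure P] (p : ℕ) {M a : ℝ≥0 → Ω → ℝ}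
    (hM : ∀ t, AEMeasurable (M t) P) (ha : ∀ t, Measurable (a t)) (hc : ∀ ω, Continuous (a · ω))
    (h0 : ∀ t ω, 0 ≤ a t ω) {C : ℝ} (hC : 0 ≤ C)
    (hJ : ∀ (N : ℕ) (T δ : ℝ≥0) (n : ℕ), 0 < δ → n * δ ≤ T →
      ∫⁻ ω in {ω | ∀ u ≤ T, a u ω ≤ N},
        ENNReal.ofReal (centredSum p M (integrated a) δ n ω ^ 2) ∂P ≤
      ENNReal.ofReal (C * (n * (N * δ) ^ p))) :
    TendstoUCP (normVariation p M)
      (fun t ω => absMoment p * integrated (fun u ω' => a u ω' ^ ((p : ℝ) / 2)) t ω) P := by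
  intro T ε hε
  set μ := absMoment p with hμ
  have hμ0 : 0 < μ := absMoment_pos p
  set g : ℝ≥0 → Ω → ℝ := fun t ω => integrated (fun u ω' => a u ω' ^ ((p : ℝ) / 2)) t ω with hgdef
  have hgc : ∀ ω, Continuous (fun t => a t ω ^ ((p : ℝ) / 2)) := fun ω =>
    (hc ω).rpow_const fun t => Or.inr (by positivity)
  have hg0 : ∀ t ω, 0 ≤ a t ω ^ ((p : ℝ) / 2) := fun t ω => Real.rpow_nonneg (h0 t ω) _
  rw [ENNReal.tendsto_nhds_zero]
  intro κ hκ
  have hκ2 : 0 < κ / 2 := ENNReal.half_pos hκ.ne'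
  obtain ⟨N, hN⟩ := ((ENNReal.tendsto_nhds_zero.1
    (tendsto_measure_forall_le_compl (P := P) ha hc T)) _ hκ2).exists
  set S : Set Ω := {ω | ∀ u ≤ T, a u ω ≤ N} with hS
  have hSm : MeasurableSet S := measurableSet_forall_le ha hc T N
  -- On `S` the limit μ g is Lipschitz on [0, T] with constant `L`; `m` is then chosen so that μ g
  -- moves by at most ε/2 on each of m equal blocks.
  set L : ℝ := μ * (N : ℝ) ^ ((p : ℝ) / 2) with hLdef
  have hL0 : 0 ≤ L := by positivity
  obtain ⟨m, hm⟩ := exists_nat_gt (2 * L * T / ε)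
  have hm0 : (0 : ℝ) < m := lt_of_le_of_lt (by positivity) hm
  have hmpos : 0 < m := by exact_mod_cast hm0
  have hLm : L * (T / m) ≤ ε / 2 := by
    rw [div_lt_iff₀ hε] at hm
    rw [← mul_div_assoc, div_le_iff₀ hm0]; nlinarith
  -- At a grid time the allowance ε/2 is shared equally between V - μU (Chebyshev on `S`) and μ(U -
  -- g) (pathwise convergence), whence the threshold ε/4/μ for U - g.
  have hε4 : 0 < ε / 4 := by positivity
  have hε4μ : 0 < ε / 4 / μ := by positivity
  have hpt : ∀ i ∈ Finset.range (m + 1), Tendsto (fun δ : ℝ≥0 => P (S ∩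
      {ω | ε / 2 ≤ |normVariation p M δ (i * (T / m)) ω - μ * g (i * (T / m)) ω|}))
      (𝓝[>] 0) (𝓝 0) := fun i hi => by
    set t : ℝ≥0 := i * (T / m) with ht
    have htT : t ≤ T := by
      calc t ≤ m * (T / m) := by
            rw [ht]; gcongr; exact Nat.lt_succ_iff.1 (Finset.mem_range.1 hi)
        _ = T := mul_div_cancel₀ _ (by positivity)
    have h1 : Tendsto (fun δ : ℝ≥0 =>
        ENNReal.ofReal (C * (N : ℝ) ^ p * t / (ε / 4) ^ 2 * δ)) (𝓝[>] 0) (𝓝 0) := by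
      have : Continuous fun δ : ℝ≥0 =>
          ENNReal.ofReal (C * (N : ℝ) ^ p * t / (ε / 4) ^ 2 * δ) :=
        ENNReal.continuous_ofReal.comp (by fun_prop)
      simpa using (this.tendsto 0).mono_left nhdsWithin_le_nhds
    have h2 := tendsto_measure_normPowerSum_deviation (P := P) p ha hc h0 t hε4μ
    refine tendsto_of_tendsto_of_tendsto_of_le_of_le' tendsto_const_nhds
      (by simpa using h1.add h2) (Eventually.of_forall fun _ => zero_le) ?_
    filter_upwards [self_mem_nhdsWithin] with δ hδ
    have hn : (⌊t / δ⌋₊ : ℝ≥0) * δ ≤ T := (floor_div_mul_le t δ).trans htT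
    refine le_trans (le_trans (measure_mono ?_) (measure_union_le _ _)) (add_le_add_left
      (measure_deviation_le hM (fun t => (measurable_integrated ha hc t).aemeasurable) hSm hC
        (Nat.cast_nonneg N) hδ (hJ N T δ _ hδ hn) hε4) _)
    rintro ω ⟨hωS, hω⟩
    by_contra hcon
    simp only [Set.mem_union, Set.mem_inter_iff, Set.mem_ofPred_eq, not_or, not_and, not_le] at hcon
    obtain ⟨hcon1, hcon2⟩ := hcon
    have hc1 := hcon1 hωS
    rw [lt_div_iff₀ hμ0, mul_comm, ← abs_of_pos hμ0, ← abs_mul, mul_sub] at hcon2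
    have := abs_add_le (normVariation p M δ t ω - μ * normPowerSum p (integrated a) δ t ω)
      (μ * normPowerSum p (integrated a) δ t ω - μ * g t ω)
    rw [sub_add_sub_cancel] at this
    have hω' : ε / 2 ≤ |normVariation p M δ t ω - μ * g t ω| := hω
    linarith
  have hsum := tendsto_finsetSum (Finset.range (m + 1)) hpt
  rw [Finset.sum_const_zero] at hsum
  filter_upwards [ENNReal.tendsto_nhds_zero.1 hsum _ hκ2] with δ hδ
  calc P {ω | ∃ t ≤ T, ε ≤ |normVariation p M δ t ω - μ * g t ω|}
      ≤ P (Sᶜ ∪ ⋃ i ∈ Finset.range (m + 1), S ∩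
        {ω | ε / 2 ≤ |normVariation p M δ (i * (T / m)) ω - μ * g (i * (T / m)) ω|}) := by
        refine measure_mono fun ω => ?_
        rintro ⟨t, htT, hω⟩
        by_contra hcon
        simp only [Set.mem_union, Set.mem_compl_iff, not_or, not_not, Set.mem_iUnion,
          Set.mem_inter_iff, Set.mem_ofPred_eq, not_exists, not_and, not_le] at hcon
        obtain ⟨hωS, hcon⟩ := hcon
        refine absurd hω (not_le.2 (abs_sub_lt_of_grid (f := fun t => normVariation p M δ t ω)
          (g := fun t => μ * g t ω) (L := L) (normVariation_mono p M δ ω)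
          ((integrated_mono (hgc ω) (hg0 · ω)).const_mul hμ0.le) (T := T) ?_ hmpos hLm
          (fun i hi => hcon i (Finset.mem_range.2 (by omega)) hωS) htT))
        intro s t hst htT
        rw [← mul_sub, hLdef, mul_assoc]
        refine mul_le_mul_of_nonneg_left (integrated_sub_le (hgc ω) hst fun u hu => ?_) hμ0.le
        exact Real.rpow_le_rpow (h0 u ω) (hωS u (hu.trans htT)) (by positivity)
    _ ≤ P Sᶜ + ∑ i ∈ Finset.range (m + 1), P (S ∩
        {ω | ε / 2 ≤ |normVariation p M δ (i * (T / m)) ω - μ * g (i * (T / m)) ω|}) :=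
        (measure_union_le _ _).trans (add_le_add_right (measure_biUnion_finset_le _ _) _)
    _ ≤ κ / 2 + κ / 2 := add_le_add hN hδ
    _ = κ := ENNReal.add_halves κ

end UCP

/-! ### Second moment bound for a Brownian motion run on an independent clock. -/

section TimeChange

variable {Ω : Type*} {mΩ : MeasurableSpace Ω} {P : Measure Ω}

theorem hasLaw_increment {B : ℝ≥0 → Ω → ℝ} (hB : IsPreBrownianReal B P) {s t : ℝ≥0}
    (hst : s ≤ t) : HasLaw (fun ω => B t ω - B s ω) (gaussianReal 0 (t - s)) P := by
  have h := hB.hasLaw_sub t s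
  have he : nndist (t : ℝ) s = t - s := by
    ext
    rw [coe_nndist, Real.dist_eq, NNReal.coe_sub hst,
      abs_of_nonneg (sub_nonneg.2 (NNReal.coe_le_coe.2 hst))]
  have h2 : nndist t.1 s.1 = t - s := he
  rw [h2] at h
  exact h

theorem indepFun_increments {B : ℝ≥0 → Ω → ℝ} (hB : IsPreBrownianReal B P) {r s t u : ℝ≥0}
    (hrs : r ≤ s) (hst : s ≤ t) (htu : t ≤ u) :
    IndepFun (fun ω => B s ω - B r ω) (fun ω => B u ω - B t ω) P := by
  have hm : Measurable fun f : ℝ≥0 → ℝ => f (u - t) := measurable_pi_apply (u - t)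
  have h := (hB.indepFun_shift t).symm.comp
    (φ := fun f : Set.Iic t → ℝ => f ⟨s, hst⟩ - f ⟨r, hrs.trans hst⟩) (by fun_prop) hm
  simp only [Function.comp_def, add_tsub_cancel_of_le htu] at h
  exact h

variable [IsProbabilityMeasure P]

theorem lintegral_sq_brownian_le {B : ℝ≥0 → Ω → ℝ} (hB : IsPreBrownianReal B P) (p n : ℕ)
    {x : ℕ → ℝ≥0} (hx : Monotone x) :
    ∫⁻ ω, ENNReal.ofReal ((∑ k ∈ Finset.range n, (|B (x (k + 1)) ω - B (x k) ω| ^ p -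
      absMoment p * ((x (k + 1) - x k : ℝ≥0) : ℝ) ^ ((p : ℝ) / 2))) ^ 2) ∂P ≤
    ENNReal.ofReal (absMoment (2 * p) *
      ∑ k ∈ Finset.range n, ((x (k + 1) - x k : ℝ≥0) : ℝ) ^ p) := by
  refine lintegral_sq_sum_abs_pow_sub_le p (Finset.range n)
    (fun k ω => B (x (k + 1)) ω - B (x k) ω) (fun k => x (k + 1) - x k)
    (fun k _ => hasLaw_increment hB (hx k.le_succ)) fun j _ k _ hjk => ?_
  rcases lt_or_gt_of_ne hjk with h | h
  · exact indepFun_increments hB (hx j.le_succ) (hx h) (hx k.le_succ)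
  · exact (indepFun_increments hB (hx k.le_succ) (hx h) (hx j.le_succ)).symm

/-- Second moment bound for the centred sum of a Brownian motion subordinated to an independent
integrated process. -/
theorem lintegral_centredSum_timeChange_le {M a B : ℝ≥0 → Ω → ℝ} (p : ℕ)
    (ha : ∀ t, Measurable (a t)) (hc : ∀ ω, Continuous (a · ω)) (h0 : ∀ t ω, 0 ≤ a t ω)
    (hB : IsBrownianReal B P)
    (hAB : IndepFun (fun ω t => integrated a t ω) (fun ω t => B t ω) P)
    (hMB : ∀ᵐ ω ∂P, ∀ t, M t ω = B (integrated a t ω).toNNReal ω)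
    (N : ℕ) (T δ : ℝ≥0) (n : ℕ) (hn : n * δ ≤ T) :
    ∫⁻ ω in {ω | ∀ u ≤ T, a u ω ≤ N},
        ENNReal.ofReal (centredSum p M (integrated a) δ n ω ^ 2) ∂P ≤
      ENNReal.ofReal (absMoment (2 * p) * (n * (N * δ) ^ p)) := by
  have hA := measurable_integrated ha hc
  set X : Ω → ℝ≥0 → ℝ := fun ω t => integrated a t ω with hX
  have hXm : Measurable X := measurable_pi_lambda _ hA
  -- The event a ≤ N is enlarged to a condition on finitely many coordinates of the path of `A`, so
  -- that its indicator is a measurable function of the frozen path.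
  set G : Set (ℝ≥0 → ℝ) := {α | ∀ k ∈ Finset.range n,
    α ((k + 1 : ℕ) * δ) - α ((k : ℕ) * δ) ≤ N * δ} with hG
  have hGm : MeasurableSet G := by
    have : G = ⋂ k ∈ Finset.range n, {α : ℝ≥0 → ℝ |
        α ((k + 1 : ℕ) * δ) - α ((k : ℕ) * δ) ≤ N * δ} := by
      ext; simp [hG]
    rw [this]
    exact Finset.measurableSet_biInter _ fun k _ =>
      measurableSet_le (by fun_prop) measurable_const
  set Φ : (ℝ≥0 → ℝ) × (ℕ → ℝ) → ℝ≥0∞ := fun z => G.indicator 1 z.1 * ENNReal.ofReal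
    ((∑ k ∈ Finset.range n, (|z.2 (k + 1) - z.2 k| ^ p -
      absMoment p * (z.1 ((k + 1 : ℕ) * δ) - z.1 ((k : ℕ) * δ)) ^ ((p : ℝ) / 2))) ^ 2) with hΦ
  have hΦm : Measurable Φ := by
    refine ((measurable_one.indicator hGm).comp measurable_fst).mul ?_
    refine ((Finset.measurable_fun_sum _ fun k _ => ?_).pow_const 2).ennreal_ofReal
    have e1 : Measurable fun z : (ℝ≥0 → ℝ) × (ℕ → ℝ) => z.2 (k + 1) - z.2 k := by fun_prop
    have e2 : Measurable fun z : (ℝ≥0 → ℝ) × (ℕ → ℝ) =>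
      z.1 ((k + 1 : ℕ) * δ) - z.1 ((k : ℕ) * δ) := by fun_prop
    exact ((measurable_norm.comp e1).pow_const p).sub ((e2.pow_const _).const_mul _)
  set τ : ℕ → (ℝ≥0 → ℝ) → ℝ≥0 := fun k α => (α ((k : ℕ) * δ)).toNNReal with hτ
  have hfreeze := lintegral_freeze (P := P) hXm.aemeasurable hB.aemeasurable hB.cont hAB
    (τ := τ) (fun k => measurable_real_toNNReal.comp (measurable_pi_apply _)) hΦm
  have hxmono : ∀ ω, Monotone fun k : ℕ => (integrated a (k * δ) ω).toNNReal := fun ω j k hjk =>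
    Real.toNNReal_mono (integrated_mono (hc ω) (h0 · ω) (by gcongr))
  -- Subtraction in `ℝ≥0` does not truncate here, since the clock is nondecreasing and nonnegative.
  have hsub : ∀ ω (k : ℕ), (((integrated a ((k + 1 : ℕ) * δ) ω).toNNReal -
      (integrated a ((k : ℕ) * δ) ω).toNNReal : ℝ≥0) : ℝ) =
      integrated a ((k + 1 : ℕ) * δ) ω - integrated a ((k : ℕ) * δ) ω := fun ω k => by
    rw [NNReal.coe_sub (hxmono ω k.le_succ), Real.coe_toNNReal _ (integrated_nonneg (h0 · ω) _),
      Real.coe_toNNReal _ (integrated_nonneg (h0 · ω) _)]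
  calc ∫⁻ ω in {ω | ∀ u ≤ T, a u ω ≤ N},
        ENNReal.ofReal (centredSum p M (integrated a) δ n ω ^ 2) ∂P
      ≤ ∫⁻ ω, Φ (X ω, fun k => B (τ k (X ω)) ω) ∂P := by
        rw [← lintegral_indicator (measurableSet_forall_le ha hc T N)]
        refine lintegral_mono_ae ?_
        filter_upwards [hMB] with ω hω
        refine Set.indicator_apply_le' (fun hωS => ?_) (fun _ => zero_le)
        have hGω : X ω ∈ G := fun k hk => by
          have hkT : ((k + 1 : ℕ) : ℝ≥0) * δ ≤ T :=
            le_trans (by gcongr; exact Finset.mem_range.1 hk) hn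
          refine (integrated_sub_le (hc ω) (by gcongr; exact k.le_succ)
            fun u hu => hωS u (hu.trans hkT)).trans (le_of_eq ?_)
          push_cast; ring
        have hGω' : (fun t => integrated a t ω) ∈ G := hGω
        simp only [hΦ, Set.indicator_of_mem hGω', Pi.one_apply, one_mul, centredSum, hω, hτ, hX]
        exact le_rfl
    _ = ∫⁻ ω, ∫⁻ ω', Φ (X ω, fun k => B (τ k (X ω)) ω') ∂P ∂P := hfreeze
    _ ≤ ∫⁻ _, ENNReal.ofReal (absMoment (2 * p) * (n * (N * δ) ^ p)) ∂P := by
        refine lintegral_mono fun ω => ?_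
        by_cases hω : X ω ∈ G
        · have hb := lintegral_sq_brownian_le hB.toIsPreBrownianReal p n (hxmono ω)
          simp only [hsub] at hb
          have hω' : (fun t => integrated a t ω) ∈ G := hω
          simp only [hΦ, Set.indicator_of_mem hω', Pi.one_apply, one_mul, hτ, hX]
          refine hb.trans (ENNReal.ofReal_le_ofReal ?_)
          refine mul_le_mul_of_nonneg_left ?_ (absMoment_nonneg _)
          calc _ ≤ ∑ k ∈ Finset.range n, ((N : ℝ) * δ) ^ p :=
                Finset.sum_le_sum fun k hk => pow_le_pow_left₀
                  (sub_nonneg.2 (integrated_mono (hc ω) (h0 · ω) (by gcongr; exact k.le_succ)))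
                  (hω k hk) p
            _ = _ := by simp
        · simp [hΦ, Set.indicator_of_notMem hω]
    _ = _ := by simp

end TimeChange

/-! ### The conditional moment identity. -/

section CondMoment

/-- Working with `lintegral` means that integrability of (A_t - A_s)^{p/2} need not be assumed: the
case G = Ω deduces it from that of |M_t - M_s|^p. -/
theorem condMomentIdentity_of_setLIntegral_eq {Ω : Type*} {𝓖 mΩ : MeasurableSpace Ω}
    {P : Measure Ω} [IsProbabilityMeasure P] {p : ℕ} {M A : ℝ≥0 → Ω → ℝ} {s t : ℝ≥0}
    (h𝓖 : 𝓖 ≤ mΩ)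
    (hM : Integrable (fun ω => |M t ω - M s ω| ^ p) P) (hA : ∀ t, Measurable (A t))
    (hmono : ∀ ω, A s ω ≤ A t ω)
    (h : ∀ G, MeasurableSet[𝓖] G → ∫⁻ ω in G, ENNReal.ofReal (|M t ω - M s ω| ^ p) ∂P =
      ∫⁻ ω in G, ENNReal.ofReal (absMoment p * (A t ω - A s ω) ^ ((p : ℝ) / 2)) ∂P) :
    CondMomentIdentity P p M A s t 𝓖 := by
  have hnn : ∀ ω, 0 ≤ absMoment p * (A t ω - A s ω) ^ ((p : ℝ) / 2) := fun ω =>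
    mul_nonneg (absMoment_nonneg p) (Real.rpow_nonneg (sub_nonneg.2 (hmono ω)) _)
  have hmeas : Measurable fun ω => absMoment p * (A t ω - A s ω) ^ ((p : ℝ) / 2) :=
    (((hA t).sub (hA s)).pow_const _).const_mul _
  have hint : Integrable (fun ω => absMoment p * (A t ω - A s ω) ^ ((p : ℝ) / 2)) P := by
    refine ⟨hmeas.aestronglyMeasurable, ?_⟩
    rw [hasFiniteIntegral_iff_ofReal (ae_of_all _ hnn)]
    have := h Set.univ MeasurableSet.univ
    rw [setLIntegral_univ, setLIntegral_univ] at this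
    rw [← this]
    exact hM.lintegral_lt_top
  have hA' : Integrable (fun ω => (A t ω - A s ω) ^ ((p : ℝ) / 2)) P := by
    have := hint.const_mul (absMoment p)⁻¹
    refine this.congr (ae_of_all _ fun ω => ?_)
    simp only
    rw [inv_mul_cancel_left₀ (absMoment_pos p).ne']
  refine ⟨hM, hA', ?_⟩
  have hce : P[fun ω => absMoment p * (A t ω - A s ω) ^ ((p : ℝ) / 2) | 𝓖] =ᵐ[P]
      P[fun ω => |M t ω - M s ω| ^ p | 𝓖] := by
    refine ae_eq_condExp_of_forall_setIntegral_eq h𝓖 hM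
      (fun _ _ _ => integrable_condExp.integrableOn) (fun G hG _ => ?_)
      stronglyMeasurable_condExp.aestronglyMeasurable
    rw [setIntegral_condExp h𝓖 hint hG, integral_eq_lintegral_of_nonneg_ae (ae_of_all _ hnn)
      hmeas.aestronglyMeasurable, integral_eq_lintegral_of_nonneg_ae
      (ae_of_all _ fun _ => by positivity) hM.aestronglyMeasurable.restrict, h G hG]
  refine hce.symm.trans ?_
  have hs := condExp_smul (μ := P) (absMoment p) (fun ω => (A t ω - A s ω) ^ ((p : ℝ) / 2)) 𝓖
  exact hs

variable {Ω : Type*} {mΩ : MeasurableSpace Ω} {P : Measure Ω}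

/-- Equality of set integrals over the past follows from equality over finite-dimensional cylinders.
-/
theorem setLIntegral_eq_of_past_cylinders {M A : ℝ≥0 → Ω → ℝ} (hM : ∀ t, Measurable (M t))
    (hA : ∀ t, Measurable (A t)) (s : ℝ≥0) {f g : Ω → ℝ≥0∞} (hf : ∫⁻ ω, f ω ∂P ≠ ∞)
    (h : ∀ (F : Finset (Set.Iic s)) (S : Set.Iic s → Set (ℝ × ℝ)),
      (∀ u ∈ F, MeasurableSet (S u)) →
      ∫⁻ ω in {ω | ∀ u ∈ F, (M u ω, A u ω) ∈ S u}, f ω ∂P =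
        ∫⁻ ω in {ω | ∀ u ∈ F, (M u ω, A u ω) ∈ S u}, g ω ∂P)
    {G : Set Ω} (hG : MeasurableSet[past M A s] G) :
    ∫⁻ ω in G, f ω ∂P = ∫⁻ ω in G, g ω ∂P := by
  have hle : past M A s ≤ mΩ := iSup_le fun u => sup_le (hM u).comap_le (hA u).comap_le
  have hgen : past M A s = MeasurableSpace.generateFrom (piiUnionInter (fun u : Set.Iic s =>
      {D | MeasurableSet[MeasurableSpace.comap (M u) inferInstance ⊔
        MeasurableSpace.comap (A u) inferInstance] D}) Set.univ) :=
    ((generateFrom_piiUnionInter_measurableSet (fun u : Set.Iic s =>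
      MeasurableSpace.comap (M u) inferInstance ⊔ MeasurableSpace.comap (A u) inferInstance)
      Set.univ).trans (by simp [past])).symm
  have huniv : ∫⁻ ω, f ω ∂P = ∫⁻ ω, g ω ∂P := by simpa using h ∅ (fun _ => ∅) (by simp)
  have : IsFiniteMeasure (P.withDensity f) := isFiniteMeasure_withDensity hf
  -- Finite intersections of events at single times form a π-system generating the past, and two
  -- finite measures agreeing on it coincide.
  have key : (P.withDensity f).trim hle = (P.withDensity g).trim hle := by
    refine ext_of_generate_finite _ hgen
      (isPiSystem_piiUnionInter _ (fun u : Set.Iic s => @MeasurableSpace.isPiSystem_measurableSet Ω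
        (MeasurableSpace.comap (M u) inferInstance ⊔ MeasurableSpace.comap (A u) inferInstance)) _)
      (fun C hC => ?_) ?_
    · have hC0 := MeasurableSpace.measurableSet_generateFrom hC
      rw [← hgen] at hC0
      obtain ⟨F, -, D, hD, rfl⟩ := hC
      have hD' : ∀ u ∈ F, ∃ S : Set (ℝ × ℝ), MeasurableSet S ∧
          (fun ω => (M u ω, A u ω)) ⁻¹' S = D u := fun u hu => by
        have := hD u hu
        rw [Set.mem_ofPred_eq, ← MeasurableSpace.comap_prodMk] at this
        exact this
      choose! S hS1 hS2 using hD'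
      have hset : ⋂ u ∈ F, D u = {ω | ∀ u ∈ F, (M u ω, A u ω) ∈ S u} := by
        ext ω
        simp only [Set.mem_iInter, Set.mem_ofPred_eq]
        refine forall₂_congr fun u hu => ?_
        rw [← hS2 u hu]; rfl
      rw [trim_measurableSet_eq hle hC0, trim_measurableSet_eq hle hC0,
        withDensity_apply _ (hle _ hC0), withDensity_apply _ (hle _ hC0), hset]
      exact h F S hS1
    · rw [trim_measurableSet_eq hle MeasurableSet.univ, trim_measurableSet_eq hle MeasurableSet.univ,
        withDensity_apply _ MeasurableSet.univ, withDensity_apply _ MeasurableSet.univ,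
        setLIntegral_univ, setLIntegral_univ, huniv]
  have := congrArg (fun ν => ν G) key
  simp only [trim_measurableSet_eq hle hG] at this
  rwa [withDensity_apply _ (hle _ hG), withDensity_apply _ (hle _ hG)] at this

variable [IsProbabilityMeasure P]

theorem integrable_abs_sub_pow {M : ℝ≥0 → Ω → ℝ} {p : ℕ}
    (hMp : ∀ t, MemLp (M t) (p : ℝ≥0∞) P) (s t : ℝ≥0) :
    Integrable (fun ω => |M t ω - M s ω| ^ p) P :=
  ((hMp t).sub (hMp s)).integrable_norm_pow'

/-- The law of an increment of Brownian motion started at an independent random time. -/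
theorem lintegral_abs_pow_random_start {B : ℝ≥0 → Ω → ℝ} (hB : IsBrownianReal B P) {X : Ω → ℝ≥0}
    (hX : Measurable X) (hXB : IndepFun X (fun ω t => B t ω) P) (p : ℕ) (d : ℝ≥0) :
    ∫⁻ ω, ENNReal.ofReal (|B (X ω + d) ω - B (X ω) ω| ^ p) ∂P =
      ENNReal.ofReal (absMoment p * (d : ℝ) ^ ((p : ℝ) / 2)) := by
  have h := lintegral_freeze (P := P) hX.aemeasurable hB.aemeasurable hB.cont hXB
    (τ := fun (b : Bool) x => if b then x + d else x)
    (fun b => by cases b <;> simp <;> fun_prop)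
    (Φ := fun z => ENNReal.ofReal (|z.2 true - z.2 false| ^ p)) (by fun_prop)
  simp only [if_true, Bool.false_eq_true, if_false] at h
  rw [h]
  have h2 : ∀ x : ℝ≥0, ∫⁻ ω, ENNReal.ofReal (|B (x + d) ω - B x ω| ^ p) ∂P =
      ENNReal.ofReal (absMoment p * (d : ℝ) ^ ((p : ℝ) / 2)) := fun x => by
    have := lintegral_abs_pow_of_hasLaw
      (hasLaw_increment hB.toIsPreBrownianReal (le_self_add (a := x) (b := d))) p
    simpa using this
  simp only [h2, lintegral_const, measure_univ, mul_one]

/-- M_t - M_s is the restarted Brownian motion at time A_t - A_s. Since it is independent of `A` and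
`𝓕 s` jointly, that time and the indicator of `G` can be frozen together. -/
theorem setLIntegral_abs_pow_of_isFreshAfter {M A B : ℝ≥0 → Ω → ℝ}
    {𝓕 : Filtration ℝ≥0 mΩ} (p : ℕ) (hA : ∀ t, Measurable (A t)) (hA0 : ∀ t ω, 0 ≤ A t ω)
    (hmono : ∀ ω, Monotone (A · ω)) (hB : IsBrownianReal B P)
    (hAB : IndepFun (fun ω t => A t ω) (fun ω t => B t ω) P)
    (hMB : ∀ᵐ ω ∂P, ∀ t, M t ω = B (A t ω).toNNReal ω) (hfresh : IsFreshAfter B A 𝓕 P)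
    {s t : ℝ≥0} (hst : s ≤ t) {G : Set Ω} (hG : MeasurableSet[𝓕 s] G) :
    ∫⁻ ω in G, ENNReal.ofReal (|M t ω - M s ω| ^ p) ∂P =
      ∫⁻ ω in G, ENNReal.ofReal (absMoment p * (A t ω - A s ω) ^ ((p : ℝ) / 2)) ∂P := by
  have hGm : MeasurableSet G := 𝓕.le s _ hG
  set B' : ℝ≥0 → Ω → ℝ := fun u ω => B ((A s ω).toNNReal + u) ω - B (A s ω).toNNReal ω with hB'
  have hAs : Measurable fun ω => (A s ω).toNNReal := measurable_real_toNNReal.comp (hA s)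
  have hB'm : ∀ u, AEMeasurable (B' u) P := fun u =>
    (aemeasurable_comp_time hB.aemeasurable hB.cont (hAs.add_const u).aemeasurable).sub
      (aemeasurable_comp_time hB.aemeasurable hB.cont hAs.aemeasurable)
  have hB'c : ∀ᵐ ω ∂P, Continuous (B' · ω) := by
    filter_upwards [hB.cont] with ω hω
    exact (hω.comp (continuous_const.add continuous_id)).sub continuous_const
  set X : Ω → ℝ × ℝ≥0∞ := fun ω => (A t ω - A s ω, G.indicator 1 ω) with hX
  have hXm : Measurable X := ((hA t).sub (hA s)).prodMk (measurable_one.indicator hGm)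
  have hXle : MeasurableSpace.comap X inferInstance ≤
      (⨆ u : ℝ≥0, MeasurableSpace.comap (A u) inferInstance) ⊔ 𝓕 s := by
    set H : MeasurableSpace Ω := (⨆ u : ℝ≥0, MeasurableSpace.comap (A u) inferInstance) ⊔ 𝓕 s
    have hAH : ∀ u, Measurable[H] (A u) := fun u => measurable_iff_comap_le.2
      ((le_iSup (fun u => MeasurableSpace.comap (A u) inferInstance) u).trans le_sup_left)
    have hXH : Measurable[H] X :=
      ((hAH t).sub (hAH s)).prodMk (measurable_one.indicator ((le_sup_right : 𝓕 s ≤ H) _ hG))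
    exact hXH.comap_le
  have hind : IndepFun X (fun ω u => B' u ω) P :=
    indep_of_indep_of_le_left (hfresh s) hXle
  have hfreeze := lintegral_freeze (P := P) hXm.aemeasurable hB'm hB'c hind
    (τ := fun (_ : Unit) x => x.1.toNNReal) (fun _ => measurable_real_toNNReal.comp measurable_fst)
    (Φ := fun z => z.1.2 * ENNReal.ofReal (|z.2 ()| ^ p)) (by fun_prop)
  have hcoord : Measurable fun α : ℝ≥0 → ℝ => (α s).toNNReal :=
    measurable_real_toNNReal.comp (measurable_pi_apply s)
  have hind0 : IndepFun (fun ω => (A s ω).toNNReal) (fun ω t => B t ω) P :=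
    hAB.comp hcoord measurable_id
  have hinner : ∀ d : ℝ≥0, ∫⁻ ω, ENNReal.ofReal (|B' d ω| ^ p) ∂P =
      ENNReal.ofReal (absMoment p * (d : ℝ) ^ ((p : ℝ) / 2)) :=
    lintegral_abs_pow_random_start hB hAs hind0 p
  rw [← lintegral_indicator hGm, ← lintegral_indicator hGm]
  calc ∫⁻ ω, G.indicator (fun ω => ENNReal.ofReal (|M t ω - M s ω| ^ p)) ω ∂P
      = ∫⁻ ω, (X ω).2 * ENNReal.ofReal (|B' (X ω).1.toNNReal ω| ^ p) ∂P := by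
        refine lintegral_congr_ae ?_
        filter_upwards [hMB] with ω hω
        have hadd : (A s ω).toNNReal + (A t ω - A s ω).toNNReal = (A t ω).toNNReal := by
          rw [← Real.toNNReal_add (hA0 s ω) (sub_nonneg.2 (hmono ω hst)), add_sub_cancel]
        by_cases hωG : ω ∈ G
        · simp [hX, hB', hωG, hadd, hω]
        · simp [hX, hωG]
    _ = ∫⁻ ω, ∫⁻ ω', (X ω).2 * ENNReal.ofReal (|B' (X ω).1.toNNReal ω'| ^ p) ∂P ∂P := hfreeze
    _ = _ := by
        refine lintegral_congr fun ω => ?_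
        rw [lintegral_const_mul'' _ ((hB'm _).abs.pow_const p).ennreal_ofReal, hinner,
          Real.coe_toNNReal _ (sub_nonneg.2 (hmono ω hst))]
        by_cases hωG : ω ∈ G
        · simp [hX, hωG]
        · simp [hX, hωG]

/-- Once the path α of `A` is frozen, the cylinder involves `B` only at times α_u ≤ α_s, and is
therefore independent of the increment of `B` from α_s to α_t. -/
theorem setLIntegral_abs_pow_past_cylinder {M A B : ℝ≥0 → Ω → ℝ} (p : ℕ)
    (hM : ∀ t, Measurable (M t))
    (hA : ∀ t, Measurable (A t)) (hA0 : ∀ t ω, 0 ≤ A t ω)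
    (hmono : ∀ ω, Monotone (A · ω)) (hB : IsBrownianReal B P)
    (hAB : IndepFun (fun ω t => A t ω) (fun ω t => B t ω) P)
    (hMB : ∀ᵐ ω ∂P, ∀ t, M t ω = B (A t ω).toNNReal ω) {s t : ℝ≥0} (hst : s ≤ t)
    (F : Finset (Set.Iic s)) (S : Set.Iic s → Set (ℝ × ℝ)) (hS : ∀ u ∈ F, MeasurableSet (S u)) :
    ∫⁻ ω in {ω | ∀ u ∈ F, (M u ω, A u ω) ∈ S u}, ENNReal.ofReal (|M t ω - M s ω| ^ p) ∂P =
      ∫⁻ ω in {ω | ∀ u ∈ F, (M u ω, A u ω) ∈ S u},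
        ENNReal.ofReal (absMoment p * (A t ω - A s ω) ^ ((p : ℝ) / 2)) ∂P := by
  set X : Ω → ℝ≥0 → ℝ := fun ω t => A t ω with hX
  have hXm : Measurable X := measurable_pi_lambda _ hA
  -- The left summand indexes the cylinder times; `true` and `false` stand for `t` and `s`.
  set τ : F ⊕ Bool → (ℝ≥0 → ℝ) → ℝ≥0 := fun i α =>
    (α (Sum.elim (fun u : F => ((u : Set.Iic s) : ℝ≥0))
      (fun b : Bool => if b then t else s) i)).toNNReal with hτ
  have hτm : ∀ i, Measurable (τ i) := fun i =>
    measurable_real_toNNReal.comp (measurable_pi_apply _)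
  set K : Set ((ℝ≥0 → ℝ) × (F ⊕ Bool → ℝ)) :=
    {z | ∀ u : F, (z.2 (Sum.inl u), z.1 (u : Set.Iic s)) ∈ S u} with hK
  have hKm : MeasurableSet K := by
    have : K = ⋂ u : F, {z | (z.2 (Sum.inl u), z.1 (u : Set.Iic s)) ∈ S u} := by
      ext; simp [hK]
    rw [this]
    refine MeasurableSet.iInter fun u => ?_
    have hm : Measurable fun z : (ℝ≥0 → ℝ) × (F ⊕ Bool → ℝ) =>
      (z.2 (Sum.inl u), z.1 (u : Set.Iic s)) := by fun_prop
    exact hm (hS u u.2)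
  have hCm : MeasurableSet {ω | ∀ u ∈ F, (M u ω, A u ω) ∈ S u} := by
    have : {ω | ∀ u ∈ F, (M u ω, A u ω) ∈ S u} = ⋂ u ∈ F, {ω | (M u ω, A u ω) ∈ S u} := by
      ext; simp
    rw [this]
    exact Finset.measurableSet_biInter _ fun u hu => ((hM u).prodMk (hA u)) (hS u hu)
  have hcyl : ∀ᵐ ω ∂P, (X ω, fun i => B (τ i (X ω)) ω) ∈ K ↔
      ω ∈ {ω | ∀ u ∈ F, (M u ω, A u ω) ∈ S u} := by
    filter_upwards [hMB] with ω hω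
    simp [hK, hτ, hX, hω]
  have hind1 : Measurable fun z : (ℝ≥0 → ℝ) × (F ⊕ Bool → ℝ) => K.indicator (1 : (ℝ≥0 → ℝ) × (F ⊕ Bool → ℝ) → ℝ≥0∞) z :=
    measurable_one.indicator hKm
  have f1 := lintegral_freeze (P := P) hXm.aemeasurable hB.aemeasurable hB.cont hAB hτm
    (Φ := fun z => K.indicator 1 z * ENNReal.ofReal (|z.2 (Sum.inr true) - z.2 (Sum.inr false)| ^ p))
    (hind1.mul (by fun_prop))
  -- The right side is frozen too, because the cylinder also depends on `B`; the two sides are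
  -- compared for each frozen path.
  have f2 := lintegral_freeze (P := P) hXm.aemeasurable hB.aemeasurable hB.cont hAB hτm
    (Φ := fun z => K.indicator 1 z *
      ENNReal.ofReal (absMoment p * (z.1 t - z.1 s) ^ ((p : ℝ) / 2)))
    (hind1.mul (((((measurable_pi_apply t).comp measurable_fst).sub
      ((measurable_pi_apply s).comp measurable_fst)).pow_const _).const_mul _).ennreal_ofReal)
  rw [← lintegral_indicator hCm, ← lintegral_indicator hCm]
  refine Eq.trans (lintegral_congr_ae ?lhs)
    (f1.trans (Eq.trans ?mid (f2.symm.trans (lintegral_congr_ae ?rhs))))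
  case lhs =>
    filter_upwards [hcyl, hMB] with ω hω hMω
    by_cases h : ω ∈ {ω | ∀ u ∈ F, (M u ω, A u ω) ∈ S u}
    · rw [Set.indicator_of_mem h, Set.indicator_of_mem (hω.2 h)]
      simp [hτ, hX, hMω]
    · rw [Set.indicator_of_notMem h, Set.indicator_of_notMem (mt hω.1 h), zero_mul]
  case rhs =>
    filter_upwards [hcyl] with ω hω
    by_cases h : ω ∈ {ω | ∀ u ∈ F, (M u ω, A u ω) ∈ S u}
    · rw [Set.indicator_of_mem h, Set.indicator_of_mem (hω.2 h)]
      simp [hX]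
    · rw [Set.indicator_of_notMem h, Set.indicator_of_notMem (mt hω.1 h), zero_mul]
  refine lintegral_congr fun ω => ?_
  set α := X ω with hα
  have hαm : Monotone fun u => (α u).toNNReal := fun u v huv =>
    Real.toNNReal_mono (hmono ω huv)
  set x := (α s).toNNReal with hx
  set y := (α t).toNNReal with hy
  have hxy : x ≤ y := hαm hst
  have hφ : Measurable fun f : Set.Iic x → ℝ => K.indicator (1 : (ℝ≥0 → ℝ) × (F ⊕ Bool → ℝ) → ℝ≥0∞)
      (α, Sum.elim (fun u : F => f ⟨(α (u : Set.Iic s)).toNNReal, hαm u.1.2⟩) fun _ => 0) := by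
    refine hind1.comp (measurable_const.prodMk (measurable_pi_lambda _ fun i => ?_))
    cases i with
    | inl u => exact measurable_pi_apply _
    | inr b => exact measurable_const
  have hψ : Measurable fun f : ℝ≥0 → ℝ => ENNReal.ofReal (|f (y - x)| ^ p) :=
    ((measurable_norm.comp (measurable_pi_apply (y - x))).pow_const p).ennreal_ofReal
  have hI := (hB.indepFun_shift x).symm.comp hφ hψ
  have hkey := lintegral_mul_eq_lintegral_mul_lintegral_of_indepFun''
    (hind1.comp_aemeasurable (aemeasurable_const.prodMk (aemeasurable_pi_lambda _ fun i => by
      cases i with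
      | inl u => exact hB.aemeasurable (α (u : Set.Iic s)).toNNReal
      | inr b => exact aemeasurable_const)))
    ((((hB.aemeasurable (x + (y - x))).sub (hB.aemeasurable x)).abs.pow_const p).ennreal_ofReal) hI
  -- `K` ignores the coordinates of the right summand, so they may be set to 0; this leaves a
  -- function of `B` up to time `x`.
  have hKeq : ∀ ω', K.indicator (1 : (ℝ≥0 → ℝ) × (F ⊕ Bool → ℝ) → ℝ≥0∞) (α, Sum.elim
      (fun u : F => B (α (u : Set.Iic s)).toNNReal ω') fun _ => 0) =
      K.indicator 1 (α, fun i => B (τ i α) ω') := fun ω' => by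
    have : ((α, Sum.elim (fun u : F => B (α (u : Set.Iic s)).toNNReal ω') fun _ => 0) ∈ K) ↔
        (α, fun i => B (τ i α) ω') ∈ K := by simp [hK, hτ]
    by_cases h : (α, fun i => B (τ i α) ω') ∈ K
    · rw [Set.indicator_of_mem h, Set.indicator_of_mem (this.2 h)]; rfl
    · rw [Set.indicator_of_notMem h, Set.indicator_of_notMem (mt this.1 h)]
  have hyx : (((y - x : ℝ≥0)) : ℝ) = α t - α s := by
    rw [NNReal.coe_sub hxy, hy, hx, Real.coe_toNNReal _ (hA0 t ω), Real.coe_toNNReal _ (hA0 s ω)]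
  have hmom := lintegral_abs_pow_of_hasLaw (hasLaw_increment hB.toIsPreBrownianReal hxy) p
  rw [hyx] at hmom
  simp only [Function.comp_def, hKeq, add_tsub_cancel_of_le hxy, Pi.sub_apply, hmom] at hkey
  change ∫⁻ ω', K.indicator 1 (α, fun i => B (τ i α) ω') *
      ENNReal.ofReal (|B y ω' - B x ω'| ^ p) ∂P = ∫⁻ ω', K.indicator 1 (α, fun i => B (τ i α) ω') *
      ENNReal.ofReal (absMoment p * (α t - α s) ^ ((p : ℝ) / 2)) ∂P
  rw [hkey, lintegral_mul_const' _ _ ENNReal.ofReal_ne_top]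

end CondMoment

/-! ### Second moment bound for Itô integrals with independent integrand. -/

section Ito

variable {Ω : Type*} {mΩ : MeasurableSpace Ω} {P : Measure Ω}

theorem hasLaw_sum_gaussianReal [IsProbabilityMeasure P] {D : ℕ → Ω → ℝ} {v : ℕ → ℝ≥0}
    (hD : ∀ j, HasLaw (D j) (gaussianReal 0 (v j)) P) (hind : iIndepFun D P) (s : Finset ℕ) :
    HasLaw (∑ j ∈ s, D j) (gaussianReal 0 (∑ j ∈ s, v j)) P := by
  classical
  induction s using Finset.induction_on with
  | empty =>
    simp only [Finset.sum_empty, gaussianReal_zero_var]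
    exact ⟨aemeasurable_const, by
      rw [show (0 : Ω → ℝ) = fun _ => (0 : ℝ) from rfl, Measure.map_const]; simp⟩
  | insert i s his ih =>
    have hI := (hind.indepFun_finsetSum_of_notMem₀ (fun j => (hD j).aemeasurable) his).symm
    rw [Finset.sum_insert his, Finset.sum_insert his]
    refine ⟨(hD i).aemeasurable.add ih.aemeasurable, ?_⟩
    have := gaussianReal_add_gaussianReal_of_indepFun hI (hD i).map_eq ih.map_eq
    rwa [add_zero] at this

theorem indepFun_weighted_sums [IsProbabilityMeasure P] {D : ℕ → Ω → ℝ}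
    (hD : ∀ j, AEMeasurable (D j) P) (hind : iIndepFun D P) (c : ℕ → ℝ) {s t : Finset ℕ}
    (hst : Disjoint s t) :
    IndepFun (fun ω => ∑ j ∈ s, c j * D j ω) (fun ω => ∑ j ∈ t, c j * D j ω) P := by
  have h := (hind.indepFun_finset₀ s t hst hD).comp
    (φ := fun f : s → ℝ => ∑ j : s, c j * f j) (ψ := fun f : t → ℝ => ∑ j : t, c j * f j)
    (by fun_prop) (by fun_prop)
  simp only [Function.comp_def] at h
  have e : ∀ (r : Finset ℕ) ω, ∑ j : r, c j * D j ω = ∑ j ∈ r, c j * D j ω := fun r ω =>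
    Finset.sum_coe_sort r (fun j => c j * D j ω)
  simpa only [e] using h

/-- Second moment bound for the block sums of a discrete Wiener integral of a deterministic
sequence. -/
theorem lintegral_sq_wiener_sums_le [IsProbabilityMeasure P] {W : ℝ≥0 → Ω → ℝ}
    (hW : IsPreBrownianReal W P) (p n m : ℕ) (η : ℝ≥0) (c : ℕ → ℝ) :
    ∫⁻ ω, ENNReal.ofReal ((∑ k ∈ Finset.range n,
      (|∑ j ∈ Finset.Ico (k * m) ((k + 1) * m),
          c j * (W ((j + 1 : ℕ) * η) ω - W ((j : ℕ) * η) ω)| ^ p -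
        absMoment p * (∑ j ∈ Finset.Ico (k * m) ((k + 1) * m),
          (η : ℝ) * c j ^ 2) ^ ((p : ℝ) / 2))) ^ 2) ∂P ≤
    ENNReal.ofReal (absMoment (2 * p) * ∑ k ∈ Finset.range n,
      (∑ j ∈ Finset.Ico (k * m) ((k + 1) * m), (η : ℝ) * c j ^ 2) ^ p) := by
  set D : ℕ → Ω → ℝ := fun j ω => W ((j + 1 : ℕ) * η) ω - W ((j : ℕ) * η) ω with hD
  have hmono : Monotone fun j : ℕ => (j : ℝ≥0) * η := fun i j hij => by
    simp only; gcongr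
  have hDlaw : ∀ j, HasLaw (D j) (gaussianReal 0 η) P := fun j => by
    have h := hasLaw_increment hW (hmono j.le_succ)
    have e : ((j + 1 : ℕ) : ℝ≥0) * η - (j : ℕ) * η = η := by
      rw [Nat.cast_succ, add_mul, one_mul, add_tsub_cancel_left]
    simp only [Nat.succ_eq_add_one, e] at h
    exact h
  have hind : iIndepFun D P := hW.hasIndepIncrements.nat hmono
  have hclaw : ∀ j, HasLaw (fun ω => c j * D j ω)
      (gaussianReal 0 (NNReal.mk (c j ^ 2) (sq_nonneg _) * η)) P := fun j => by
    simpa using gaussianReal_const_mul (hDlaw j) (c j)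
  have hcind : iIndepFun (fun j ω => c j * D j ω) P :=
    hind.comp (fun j x => c j * x) fun j => by fun_prop
  set v : ℕ → ℝ≥0 := fun k => ∑ j ∈ Finset.Ico (k * m) ((k + 1) * m),
    NNReal.mk (c j ^ 2) (sq_nonneg _) * η with hv
  have hvc : ∀ k, ((v k : ℝ≥0) : ℝ) = ∑ j ∈ Finset.Ico (k * m) ((k + 1) * m), (η : ℝ) * c j ^ 2 :=
    fun k => by
      rw [hv, NNReal.coe_sum]
      exact Finset.sum_congr rfl fun j _ => by rw [NNReal.coe_mul, mul_comm]; rfl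
  have hlaw : ∀ k, HasLaw (fun ω => ∑ j ∈ Finset.Ico (k * m) ((k + 1) * m), c j * D j ω)
      (gaussianReal 0 (v k)) P := fun k => by
    have := hasLaw_sum_gaussianReal hclaw hcind (Finset.Ico (k * m) ((k + 1) * m))
    convert this using 1
    ext ω; simp
  have hdisj : ∀ i j : ℕ, i < j → Disjoint (Finset.Ico (i * m) ((i + 1) * m))
      (Finset.Ico (j * m) ((j + 1) * m)) := fun i j hij =>
    Finset.disjoint_left.2 fun x hx hx' => by
      have := Nat.mul_le_mul_right m hij
      rw [Finset.mem_Ico] at hx hx'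
      simp only [Nat.succ_eq_add_one] at this
      omega
  have h := lintegral_sq_sum_abs_pow_sub_le p (Finset.range n) _ v (fun k _ => hlaw k)
    fun i _ j _ hij => by
      rcases lt_or_gt_of_ne hij with h | h
      · exact indepFun_weighted_sums (fun j => (hDlaw j).aemeasurable) hind c (hdisj _ _ h)
      · exact (indepFun_weighted_sums (fun j => (hDlaw j).aemeasurable) hind c (hdisj _ _ h)).symm
  simpa only [hvc] using h

theorem floor_mul_div_div {δ : ℝ≥0} (hδ : 0 < δ) {m : ℕ} (hm : 0 < m) (k : ℕ) :
    ⌊(k : ℝ≥0) * δ / (δ / m)⌋₊ = k * m := by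
  have hm' : (m : ℝ≥0) ≠ 0 := by positivity
  have : (k : ℝ≥0) * δ / (δ / m) = (k * m : ℕ) := by
    push_cast; field_simp
  rw [this, Nat.floor_natCast]

theorem itoSum_at_grid (σ W : ℝ≥0 → Ω → ℝ) {δ : ℝ≥0} (hδ : 0 < δ) {m : ℕ} (hm : 0 < m) (k : ℕ)
    (ω : Ω) : itoSum σ W (δ / m) (k * δ) ω = ∑ j ∈ Finset.range (k * m),
      σ ((j : ℕ) * (δ / m)) ω *
        (W ((j + 1 : ℕ) * (δ / m)) ω - W ((j : ℕ) * (δ / m)) ω) := by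
  have hm' : (m : ℝ≥0) ≠ 0 := by positivity
  have hk : (k : ℝ≥0) * δ = (k * m : ℕ) * (δ / m) := by
    push_cast; field_simp
  have hle : ∀ i : ℕ, i ≤ k * m → min ((i : ℝ≥0) * (δ / m)) (k * δ) = i * (δ / m) := fun i hi => by
    rw [hk]; exact min_eq_left (by gcongr)
  rw [itoSum, floor_mul_div_div hδ hm, Finset.sum_range_succ]
  -- The mesh δ/m divides kδ, so the extra last term j = km has both endpoints capped at kδ and
  -- vanishes.
  have hlast : min (((k * m + 1 : ℕ) : ℝ≥0) * (δ / m)) (k * δ) = k * δ :=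
    min_eq_right (by rw [hk]; gcongr; exact Nat.le_succ _)
  rw [hlast, hle _ le_rfl, ← hk, sub_self, mul_zero, add_zero]
  refine Finset.sum_congr rfl fun j hj => ?_
  have hj' := Finset.mem_range.1 hj
  rw [hle _ hj', hle _ hj'.le]

/-- Left-point Riemann sums over one block of length `δ`. -/
theorem tendsto_block_riemann_sum {a : ℝ≥0 → Ω → ℝ} {ω : Ω} (hc : Continuous (a · ω)) {δ : ℝ≥0}
    (hδ : 0 < δ) (k : ℕ) :
    Tendsto (fun m : ℕ => ∑ j ∈ Finset.Ico (k * m) ((k + 1) * m),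
      ((δ / m : ℝ≥0) : ℝ) * a ((j : ℕ) * (δ / m)) ω) atTop
      (𝓝 (integrated a ((k + 1 : ℕ) * δ) ω - integrated a ((k : ℕ) * δ) ω)) := by
  have hpt : ∀ i : ℕ, Tendsto (fun m : ℕ => ∑ j ∈ Finset.range (i * m),
      ((δ / m : ℝ≥0) : ℝ) * a ((j : ℕ) * (δ / m)) ω) atTop (𝓝 (integrated a (i * δ) ω)) := fun i => by
    rw [Metric.tendsto_atTop']
    intro ε hε
    obtain ⟨δ₀, hδ₀, H⟩ := riemann_sum_close hc (i * δ) (half_pos hε)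
    obtain ⟨m₀, hm₀⟩ := exists_nat_gt (δ / δ₀)
    refine ⟨m₀, fun m hm => ?_⟩
    have hm0 : 0 < m := by omega
    have hm' : (0 : ℝ≥0) < m := by exact_mod_cast hm0
    have hlt : δ / m < δ₀ := by
      rw [div_lt_iff₀ hm', mul_comm, ← div_lt_iff₀ hδ₀]
      exact hm₀.trans (by exact_mod_cast hm)
    have := H (δ / m) (div_pos hδ hm') hlt (fun j => j * (δ / m))
      (fun j => ⟨le_rfl, by gcongr; exact j.le_succ⟩) (i * δ) le_rfl
    rw [floor_mul_div_div hδ hm0] at this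
    rw [Real.dist_eq]
    exact this.trans_lt (half_lt_self hε)
  refine ((hpt (k + 1)).sub (hpt k)).congr fun m => ?_
  rw [Finset.sum_Ico_eq_sub _ (Nat.mul_le_mul_right m k.le_succ)]

/-- The second moment bound for the discrete stochastic integral with respect to an independent
Brownian motion. -/
theorem lintegral_sq_itoSum_le [IsProbabilityMeasure P] {σ W : ℝ≥0 → Ω → ℝ}
    (hσ : ∀ t, Measurable (σ t)) (hc : ∀ ω, Continuous (σ · ω)) (hW : IsBrownianReal W P)
    (hind : IndepFun (fun ω t => σ t ω) (fun ω t => W t ω) P) (p : ℕ)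
    (N : ℕ) (T δ : ℝ≥0) (n : ℕ) (hn : n * δ ≤ T) {m : ℕ} (hm : 0 < m) :
    ∫⁻ ω in {ω | ∀ u ≤ T, σ u ω ^ 2 ≤ N}, ENNReal.ofReal ((∑ k ∈ Finset.range n,
      (|∑ j ∈ Finset.Ico (k * m) ((k + 1) * m), σ ((j : ℕ) * (δ / m)) ω *
          (W ((j + 1 : ℕ) * (δ / m)) ω - W ((j : ℕ) * (δ / m)) ω)| ^ p -
        absMoment p * (∑ j ∈ Finset.Ico (k * m) ((k + 1) * m),
          ((δ / m : ℝ≥0) : ℝ) * σ ((j : ℕ) * (δ / m)) ω ^ 2) ^ ((p : ℝ) / 2))) ^ 2) ∂P ≤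
    ENNReal.ofReal (absMoment (2 * p) * (n * (N * δ) ^ p)) := by
  set η : ℝ≥0 := δ / m with hη
  have hm' : (m : ℝ≥0) ≠ 0 := by positivity
  set X : Ω → ℝ≥0 → ℝ := fun ω t => σ t ω with hX
  have hXm : Measurable X := measurable_pi_lambda _ hσ
  set G : Set (ℝ≥0 → ℝ) := {α | ∀ j ∈ Finset.range (n * m), α ((j : ℕ) * η) ^ 2 ≤ N} with hG
  have hGm : MeasurableSet G := by
    have : G = ⋂ j ∈ Finset.range (n * m), {α : ℝ≥0 → ℝ | α ((j : ℕ) * η) ^ 2 ≤ N} := by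
      ext; simp [hG]
    rw [this]
    exact Finset.measurableSet_biInter _ fun k _ =>
      measurableSet_le (by fun_prop) measurable_const
  set Φ : (ℝ≥0 → ℝ) × (ℕ → ℝ) → ℝ≥0∞ := fun z => G.indicator 1 z.1 * ENNReal.ofReal
    ((∑ k ∈ Finset.range n, (|∑ j ∈ Finset.Ico (k * m) ((k + 1) * m),
        z.1 ((j : ℕ) * η) * (z.2 (j + 1) - z.2 j)| ^ p -
      absMoment p * (∑ j ∈ Finset.Ico (k * m) ((k + 1) * m),
        (η : ℝ) * z.1 ((j : ℕ) * η) ^ 2) ^ ((p : ℝ) / 2))) ^ 2) with hΦ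
  have hΦm : Measurable Φ := by
    refine ((measurable_one.indicator hGm).comp measurable_fst).mul ?_
    refine ((Finset.measurable_fun_sum _ fun k _ => ?_).pow_const 2).ennreal_ofReal
    have e1 : Measurable fun z : (ℝ≥0 → ℝ) × (ℕ → ℝ) => ∑ j ∈ Finset.Ico (k * m) ((k + 1) * m),
      z.1 ((j : ℕ) * η) * (z.2 (j + 1) - z.2 j) := by fun_prop
    have e2 : Measurable fun z : (ℝ≥0 → ℝ) × (ℕ → ℝ) =>
      ∑ j ∈ Finset.Ico (k * m) ((k + 1) * m), (η : ℝ) * z.1 ((j : ℕ) * η) ^ 2 := by fun_prop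
    exact ((measurable_norm.comp e1).pow_const p).sub ((e2.pow_const _).const_mul _)
  -- Here the times are deterministic; only the coefficients σ are frozen.
  have hfreeze := lintegral_freeze (P := P) hXm.aemeasurable hW.aemeasurable hW.cont hind
    (τ := fun (j : ℕ) _ => (j : ℝ≥0) * η) (fun j => measurable_const) hΦm
  have hSm : MeasurableSet {ω | ∀ u ≤ T, σ u ω ^ 2 ≤ N} :=
    measurableSet_forall_le (a := fun u ω => σ u ω ^ 2) (fun t => (hσ t).pow_const 2)
      (fun ω => (hc ω).pow 2) T N
  rw [← lintegral_indicator hSm]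
  calc _ ≤ ∫⁻ ω, Φ (X ω, fun j : ℕ => W (j * η) ω) ∂P := by
        refine lintegral_mono fun ω => ?_
        refine Set.indicator_apply_le' (fun hωS => ?_) (fun _ => zero_le)
        have hGω : (fun t => σ t ω) ∈ G := fun j hj => by
          refine hωS _ (le_trans ?_ hn)
          calc (j : ℝ≥0) * η ≤ (n * m : ℕ) * η := by
                gcongr; exact (Finset.mem_range.1 hj).le
            _ = n * δ := by rw [hη]; push_cast; field_simp
        simp only [hΦ, hX, Set.indicator_of_mem hGω, Pi.one_apply, one_mul]
        exact le_rfl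
    _ = ∫⁻ ω, ∫⁻ ω', Φ (X ω, fun j : ℕ => W (j * η) ω') ∂P ∂P := hfreeze
    _ ≤ ∫⁻ _, ENNReal.ofReal (absMoment (2 * p) * (n * (N * δ) ^ p)) ∂P := by
        refine lintegral_mono fun ω => ?_
        by_cases hω : (fun t => σ t ω) ∈ G
        · have hb := lintegral_sq_wiener_sums_le hW.toIsPreBrownianReal p n m η
            (fun j => σ (j * η) ω)
          simp only [hΦ, hX, Set.indicator_of_mem hω, Pi.one_apply, one_mul]
          refine hb.trans (ENNReal.ofReal_le_ofReal ?_)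
          refine mul_le_mul_of_nonneg_left ?_ (absMoment_nonneg _)
          calc _ ≤ ∑ k ∈ Finset.range n, ((N : ℝ) * δ) ^ p := by
                refine Finset.sum_le_sum fun k hk => pow_le_pow_left₀
                  (Finset.sum_nonneg fun j _ => by positivity) ?_ p
                calc ∑ j ∈ Finset.Ico (k * m) ((k + 1) * m), (η : ℝ) * σ (j * η) ω ^ 2
                    ≤ ∑ j ∈ Finset.Ico (k * m) ((k + 1) * m), (η : ℝ) * N := by
                      refine Finset.sum_le_sum fun j hj => ?_
                      refine mul_le_mul_of_nonneg_left (hω j (Finset.mem_range.2 ?_)) η.2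
                      exact (Finset.mem_Ico.1 hj).2.trans_le
                        (Nat.mul_le_mul_right m (Finset.mem_range.1 hk))
                  _ = N * δ := by
                      have hm'' : (m : ℝ) ≠ 0 := by positivity
                      rw [Finset.sum_const, Nat.card_Ico, add_mul, one_mul, Nat.add_sub_cancel_left,
                        nsmul_eq_mul, hη]
                      push_cast; field_simp
            _ = _ := by simp
        · simp [hΦ, hX, Set.indicator_of_notMem hω]
    _ = _ := by simp

/-- Along a subsequence of meshes, the discrete stochastic integrals converge almost surely at the
points `kδ`, `k ≤ n`. -/
theorem exists_subseq_itoSum_tendsto {M σ W : ℝ≥0 → Ω → ℝ} (h : TendstoUCP (itoSum σ W) M P)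
    {δ : ℝ≥0} (hδ : 0 < δ) (n : ℕ) :
    ∃ ns : ℕ → ℕ, StrictMono ns ∧ ∀ᵐ ω ∂P, ∀ k ≤ n,
      Tendsto (fun i => itoSum σ W (δ / (ns i : ℕ)) (k * δ) ω) atTop (𝓝 (M (k * δ) ω)) := by
  have hmesh : Tendsto (fun m : ℕ => δ / (m : ℝ≥0)) atTop (𝓝[>] 0) := by
    refine tendsto_nhdsWithin_iff.2 ⟨?_, ?_⟩
    · rw [← NNReal.tendsto_coe]
      simpa using tendsto_const_div_atTop_nhds_zero_nat (δ : ℝ)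
    · filter_upwards [eventually_gt_atTop 0] with m hm
      exact div_pos hδ (by exact_mod_cast hm)
  -- The values at all kδ, k ≤ n, are treated as one vector, so that a single subsequence serves
  -- every k.
  have hmeas : TendstoInMeasure P
      (fun (m : ℕ) ω (k : Fin (n + 1)) => itoSum σ W (δ / (m : ℕ)) ((k : ℕ) * δ) ω) atTop
      (fun ω (k : Fin (n + 1)) => M ((k : ℕ) * δ) ω) := by
    rw [tendstoInMeasure_iff_dist]
    intro ε hε
    refine tendsto_of_tendsto_of_tendsto_of_le_of_le tendsto_const_nhds
      ((h (n * δ) ε hε).comp hmesh) (fun _ => zero_le) fun m => measure_mono fun ω hω => ?_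
    by_contra hcon
    simp only [Set.mem_ofPred_eq, not_exists, not_and, not_le] at hcon hω
    refine absurd hω (not_le.2 ((dist_pi_lt_iff hε).2 fun k => ?_))
    rw [Real.dist_eq]
    exact hcon _ (by gcongr; exact Nat.lt_succ_iff.1 k.2)
  obtain ⟨ns, hns, hae⟩ := hmeas.exists_seq_tendsto_ae
  refine ⟨ns, hns, ?_⟩
  filter_upwards [hae] with ω hω k hk
  exact (tendsto_pi_nhds.1 hω) ⟨k, Nat.lt_succ_iff.2 hk⟩

/-- Second moment bound for the centred sum of an Itô integral with an independent integrand. -/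
theorem lintegral_centredSum_ito_le [IsProbabilityMeasure P] {M σ W : ℝ≥0 → Ω → ℝ}
    (hσ : ∀ t, Measurable (σ t)) (hc : ∀ ω, Continuous (σ · ω)) (hW : IsBrownianReal W P)
    (hind : IndepFun (fun ω t => σ t ω) (fun ω t => W t ω) P)
    (hM : TendstoUCP (itoSum σ W) M P) (p : ℕ)
    (N : ℕ) (T δ : ℝ≥0) (n : ℕ) (hδ : 0 < δ) (hn : n * δ ≤ T) :
    ∫⁻ ω in {ω | ∀ u ≤ T, σ u ω ^ 2 ≤ N},
        ENNReal.ofReal (centredSum p M (integrated fun u ω => σ u ω ^ 2) δ n ω ^ 2) ∂P ≤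
      ENNReal.ofReal (absMoment (2 * p) * (n * (N * δ) ^ p)) := by
  obtain ⟨ns, hns, hae⟩ := exists_subseq_itoSum_tendsto hM hδ n
  set S : Set Ω := {ω | ∀ u ≤ T, σ u ω ^ 2 ≤ N}
  set Y : ℕ → ℕ → Ω → ℝ := fun m k ω => ∑ j ∈ Finset.Ico (k * m) ((k + 1) * m),
    σ ((j : ℕ) * (δ / m)) ω * (W ((j + 1 : ℕ) * (δ / m)) ω - W ((j : ℕ) * (δ / m)) ω) with hY
  set v : ℕ → ℕ → Ω → ℝ := fun m k ω => ∑ j ∈ Finset.Ico (k * m) ((k + 1) * m),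
    ((δ / m : ℝ≥0) : ℝ) * σ ((j : ℕ) * (δ / m)) ω ^ 2 with hv
  set F : ℕ → Ω → ℝ≥0∞ := fun m ω => ENNReal.ofReal ((∑ k ∈ Finset.range n,
    (|Y m k ω| ^ p - absMoment p * v m k ω ^ ((p : ℝ) / 2))) ^ 2) with hF
  have hFm : ∀ m, AEMeasurable (F m) (P.restrict S) := fun m => by
    have hYm : ∀ k, AEMeasurable (Y m k) P := fun k =>
      Finset.aemeasurable_fun_sum _ fun j _ => (hσ _).aemeasurable.mul
        ((hW.aemeasurable _).sub (hW.aemeasurable _))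
    have hvm : ∀ k, AEMeasurable (v m k) P := fun k =>
      Finset.aemeasurable_fun_sum _ fun j _ => (((hσ _).pow_const 2).const_mul _).aemeasurable
    exact ((Finset.aemeasurable_fun_sum _ fun k _ => ((hYm k).abs.pow_const p).sub
      (((hvm k).pow_const _).const_mul _)).pow_const 2).ennreal_ofReal.restrict
  have hlim : ∀ᵐ ω ∂P, Tendsto (fun i => F (ns i) ω) atTop
      (𝓝 (ENNReal.ofReal (centredSum p M (integrated fun u ω => σ u ω ^ 2) δ n ω ^ 2))) := by
    filter_upwards [hae] with ω hω
    refine (ENNReal.continuous_ofReal.tendsto _).comp (Tendsto.pow (tendsto_finsetSum _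
      fun k hk => ?_) 2)
    have hk' := Finset.mem_range.1 hk
    have h1 : Tendsto (fun i => Y (ns i) k ω) atTop
        (𝓝 (M ((k + 1 : ℕ) * δ) ω - M ((k : ℕ) * δ) ω)) := by
      refine ((hω (k + 1) hk').sub (hω k hk'.le)).congr' ?_
      filter_upwards [hns.tendsto_atTop.eventually_gt_atTop 0] with i hi
      rw [itoSum_at_grid σ W hδ hi, itoSum_at_grid σ W hδ hi]
      exact (Finset.sum_Ico_eq_sub _ (Nat.mul_le_mul_right (ns i) k.le_succ)).symm
    have h2 : Tendsto (fun i => v (ns i) k ω) atTop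
        (𝓝 (integrated (fun u ω => σ u ω ^ 2) ((k + 1 : ℕ) * δ) ω -
          integrated (fun u ω => σ u ω ^ 2) ((k : ℕ) * δ) ω)) :=
      (tendsto_block_riemann_sum (a := fun u ω => σ u ω ^ 2) ((hc ω).pow 2) hδ k).comp
        hns.tendsto_atTop
    exact (h1.abs.pow p).sub ((h2.rpow_const (Or.inr (by positivity))).const_mul _)
  -- Fatou's lemma transfers the bound, which does not depend on the mesh δ/m, to the limit.
  calc _ = ∫⁻ ω in S, liminf (fun i => F (ns i) ω) atTop ∂P := by
        refine lintegral_congr_ae (ae_restrict_of_ae ?_)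
        filter_upwards [hlim] with ω hω using hω.liminf_eq.symm
    _ ≤ liminf (fun i => ∫⁻ ω in S, F (ns i) ω ∂P) atTop := lintegral_liminf_le' fun i => hFm _
    _ ≤ _ := by
        refine liminf_le_of_le (by isBoundedDefault) fun b hb => ?_
        obtain ⟨i, hi, hi0⟩ := (hb.and (hns.tendsto_atTop.eventually_gt_atTop 0)).exists
        exact hi.trans (lintegral_sq_itoSum_le hσ hc hW hind p N T δ n hn hi0)

end Ito

end PVariation

end

theorem mainTheorem5 {Ω : Type*} [MeasurableSpace Ω] (P : Measure Ω) [IsProbabilityMeasure P]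
    (𝓕 : Filtration ℝ≥0 ‹MeasurableSpace Ω›) (p : ℕ) (hp : 2 ≤ p)
    (M : ℝ≥0 → Ω → ℝ) (hM : Martingale M 𝓕 P) (hM0 : ∀ᵐ ω ∂P, M 0 ω = 0)
    (hMp : ∀ t, MemLp (M t) (p : ℝ≥0∞) P) :
    (∀ a B : ℝ≥0 → Ω → ℝ,
      StronglyAdapted 𝓕 a →
      (∀ ω, Continuous (fun t => a t ω)) →
      (∀ t ω, 0 ≤ a t ω) →
      PVariation.IsCompensator (PVariation.integrated a) M 𝓕 P →
      IsBrownianReal B P →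
      IndepFun (fun ω t => PVariation.integrated a t ω) (fun ω t => B t ω) P →
      (∀ᵐ ω ∂P, ∀ t, M t ω = B (PVariation.integrated a t ω).toNNReal ω) →
      (∀ s t, s ≤ t → PVariation.CondMomentIdentity P p M (PVariation.integrated a) s t
        (PVariation.past M (PVariation.integrated a) s)) ∧
      (PVariation.IsFreshAfter B (PVariation.integrated a) 𝓕 P →
        ∀ s t, s ≤ t → PVariation.CondMomentIdentity P p M (PVariation.integrated a) s t (𝓕 s)) ∧
      (∀ᵐ ω ∂P, ∀ T : ℝ≥0, TendstoUniformlyOn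
        (fun δ t => PVariation.normPowerSum p (PVariation.integrated a) δ t ω)
        (fun t => PVariation.integrated (fun u ω' => a u ω' ^ ((p : ℝ) / 2)) t ω)
        (𝓝[>] 0) (Set.Iic T)) ∧
      ((∀ t, MemLp (M t) ((2 * p : ℕ) : ℝ≥0∞) P) →
        PVariation.TendstoUCP (PVariation.normVariation p M)
          (fun t ω => PVariation.absMoment p *
            PVariation.integrated (fun u ω' => a u ω' ^ ((p : ℝ) / 2)) t ω) P)) ∧
    ((∀ t, MemLp (M t) ((2 * p : ℕ) : ℝ≥0∞) P) →
      ∀ σ W : ℝ≥0 → Ω → ℝ,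
        (∀ t, Measurable (σ t)) →
        (∀ ω, Continuous (fun t => σ t ω)) →
        (∀ t ω, 0 ≤ σ t ω) →
        IsBrownianReal W P →
        IndepFun (fun ω t => σ t ω) (fun ω t => W t ω) P →
        PVariation.IsItoIntegral M σ W P →
        PVariation.TendstoUCP (PVariation.normVariation p M)
          (fun t ω => PVariation.absMoment p *
            PVariation.integrated (fun u ω' => σ u ω' ^ p) t ω) P) := by
  have hMm : ∀ t, Measurable (M t) := fun t =>
    (hM.stronglyMeasurable t).measurable.mono (𝓕.le t) le_rfl
  refine ⟨fun a B haad hac ha0 _ hB hAB hMB => ?_, fun _ σ W hσ hσc hσ0 hW hind hito => ?_⟩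
  · have ha : ∀ t, Measurable (a t) := fun t =>
      (haad t).measurable.mono (𝓕.le t) le_rfl
    have hA := PVariation.measurable_integrated ha hac
    have hA0 : ∀ t ω, 0 ≤ PVariation.integrated a t ω := fun t ω =>
      PVariation.integrated_nonneg (ha0 · ω) t
    have hmono : ∀ ω, Monotone (PVariation.integrated a · ω) := fun ω =>
      PVariation.integrated_mono (hac ω) (ha0 · ω)
    refine ⟨fun s t hst => ?_, fun hfresh s t hst => ?_, ?_, fun _ => ?_⟩
    · refine PVariation.condMomentIdentity_of_setLIntegral_eq
        (iSup_le fun u => sup_le (hMm u).comap_le (hA u).comap_le)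
        (PVariation.integrable_abs_sub_pow hMp s t) hA (fun ω => hmono ω hst) fun G hG => ?_
      exact PVariation.setLIntegral_eq_of_past_cylinders hMm hA s
        (PVariation.integrable_abs_sub_pow hMp s t).lintegral_lt_top.ne
        (PVariation.setLIntegral_abs_pow_past_cylinder p hMm hA hA0 hmono hB hAB hMB hst) hG
    · exact PVariation.condMomentIdentity_of_setLIntegral_eq (𝓕.le s)
        (PVariation.integrable_abs_sub_pow hMp s t) hA (fun ω => hmono ω hst) fun G hG =>
        PVariation.setLIntegral_abs_pow_of_isFreshAfter p hA hA0 hmono hB hAB hMB hfresh hst hG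
    · exact ae_of_all _ fun ω T =>
        PVariation.tendstoUniformlyOn_normPowerSum p (hac ω) (ha0 · ω) T
    · exact PVariation.tendstoUCP_normVariation p (fun t => (hMm t).aemeasurable) ha hac ha0
        (PVariation.absMoment_nonneg (2 * p)) fun N T δ n _ hn =>
        PVariation.lintegral_centredSum_timeChange_le p ha hac ha0 hB hAB hMB N T δ n hn
  -- Here σ² plays the role of a, and (σ²)^{p/2} = σ^p because σ ≥ 0.
  · have h := PVariation.tendstoUCP_normVariation p (a := fun u ω => σ u ω ^ 2)
      (fun t => (hMm t).aemeasurable) (fun t => (hσ t).pow_const 2) (fun ω => (hσc ω).pow 2)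
      (fun _ _ => sq_nonneg _) (PVariation.absMoment_nonneg (2 * p)) fun N T δ n hδ hn =>
      PVariation.lintegral_centredSum_ito_le hσ hσc hW hind hito.tendsto p N T δ n hδ hn
    have hpow : ∀ u ω, (σ u ω ^ 2) ^ ((p : ℝ) / 2) = σ u ω ^ p := fun u ω => by
      rw [← Real.rpow_natCast, ← Real.rpow_mul (hσ0 u ω), ← Real.rpow_natCast]
      congr 1; push_cast; ring
    simpa only [hpow] using h
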